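/- Let $R=\bigoplus_{i\ge 0}R_i$ be a (commutative) Noetherian $\mathbb{N}$-graded ring, let $M$ be a finitely generated $\mathbb{Z}$-graded $R$-module, $N\subseteq M$ a graded submodule, and let $I$ be an ideal of $R$ generated by homogeneous elements $y_1,\dots,y_c$ of degrees $d_1,\dots,d_c\in\mathbb{N}$ respectively. Notation. Write $(0:_M I)=\{x\in M: Ix=0\}$ and $V(I)=\{\mathfrak p\in\operatorname{Spec}R: I\subseteq\mathfrak p\}$. For a graded module $L$ and a prime $\mathfrak p\in\operatorname{Ass}_R(L)$ put $$v_{\mathfrak p}(L)=\inf\{\,j\in\mathbb{Z}:\ \mathfrak p=(0:_R x)\text{ for some }x\in L_j\,\},\qquad v(L)=\inf\{v_{\mathfrak p}(L):\mathfrak p\in\operatorname{Ass}_R(L)\},$$ with $v(0)=\infty$; submodules and quotients carry the induced gradings. The sets $\operatorname{Ass}_R(M/I^nN)$ and $\operatorname{Ass}_R(I^{n-1}N/I^nN)$ are known to be independent of $n$ for $n\gg0$; let $\mathcal A=\mathcal A^M_N(I)$ and $\mathcal B=\mathcal B_N(I)$ denote their stable values, that is, the sets of primes belonging to $\operatorname{Ass}_R(M/I^nN)$,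 respectively to $\operatorname{Ass}_R(I^{n-1}N/I^nN)$, for all $n\gg 0$. Then the following hold. 1. Let $\mathfrak p\in\mathcal A\smallsetminus\operatorname{Ass}_R(0:_M I)$ with $I\subseteq\mathfrak p$. Then $\mathfrak p\in\mathcal B$, and there exist $a_{\mathfrak p}\in\{d_1,\dots,d_c\}$ and $b_{\mathfrak p}\in\mathbb{Z}$ such that $$v_{\mathfrak p}(M/I^nN)=v_{\mathfrak p}(I^{n-1}N/I^nN)=a_{\mathfrak p}n+b_{\mathfrak p}\quad\text{for all } n\gg0.$$ 2. Let $\mathfrak p\in\mathcal A\cap\operatorname{Ass}_R(0:_M I)$. If $d_i\ge1$ for all $1\le i\le c$, then $$v_{\mathfrak p}(M/I^nN)=v_{\mathfrak p}(M)=v_{\mathfrak p}(0:_M I)\quad\text{for all } n\gg0.$$ 3. Let $(0:_M I)\ne0$. Then $v(M/I^nN)\le v(0:_M I)$ for all $n\gg0$. If moreover $d_i\ge1$ for all $1\le i\le c$ and $\mathcal A\subseteq V(I)$, then $v(M/I^nN)=v(0:_M I)$ for all $n\gg0$. 4. Let $(0:_M I)=0$ and $\emptyset\neq\mathcal A\subseteq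 V(I)$. Then there exist $a\in\{d_1,\dots,d_c\}$ and $b\in\mathbb{Z}$ such that $$v(M/I^nN)=v(I^{n-1}N/I^nN)=an+b\quad\text{for all } n\gg0.$$ -/

import Mathlib

open Filter

noncomputable section

namespace VNumber

variable {R : Type*} [CommRing R] {M : Type*} [AddCommGroup M] [Module R M]

/-- The grading induced on a submodule `P` of a graded module: `P_j = P ∩ M_j`. -/
def subGrading (ℳ : ℤ → AddSubgroup M) (P : Submodule R M) : ℤ → AddSubgroup P :=
  fun j => (ℳ j).comap P.subtype.toAddMonoidHom

/-- The grading induced on a quotient `M / P` of a graded module: `(M / P)_j` is the image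
of `M_j`. -/
def quotGrading (ℳ : ℤ → AddSubgroup M) (P : Submodule R M) : ℤ → AddSubgroup (M ⧸ P) :=
  fun j => (ℳ j).map P.mkQ.toAddMonoidHom

/-- The local Vasconcelos invariant
`v_𝔭(M) = inf { j : 𝔭 = (0 :_R x) for some x ∈ M_j }`, an infimum in the extended reals
(so it is `⊤` when there is no such `x`). -/
def localV (ℳ : ℤ → AddSubgroup M) (𝔭 : Ideal R) : EReal :=
  ⨅ (j : ℤ) (_ : ∃ x ∈ ℳ j, 𝔭 = (⊥ : Submodule R M).colon {x}), ((j : ℝ) : EReal)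

variable (R) in
/-- The Vasconcelos invariant `v(M) = inf { v_𝔭(M) : 𝔭 ∈ Ass_R(M) }`; `v(0) = ⊤`. -/
def globalV (ℳ : ℤ → AddSubgroup M) : EReal :=
  ⨅ 𝔭 ∈ associatedPrimes R M, localV ℳ 𝔭

/-- The colon submodule `(0 :_M I) = { x ∈ M : I x = 0 }`. -/
abbrev colonZero (M : Type*) [AddCommGroup M] [Module R M] (I : Ideal R) : Submodule R M :=
  Submodule.torsionBySet R M (I : Set R)

/-- The module `M / I ^ n N`. -/
abbrev QuotPow (I : Ideal R) (N : Submodule R M) (n : ℕ) : Type _ :=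
  M ⧸ (I ^ n • N)

/-- The module `I ^ (n - 1) N / I ^ n N` (meant for `n ≥ 1`). -/
abbrev GrPow (I : Ideal R) (N : Submodule R M) (n : ℕ) : Type _ :=
  ↥(I ^ (n - 1) • N) ⧸ (I ^ n • N).submoduleOf (I ^ (n - 1) • N)

/-- The grading of `M / I ^ n N`. -/
abbrev quotPowGrading (ℳ : ℤ → AddSubgroup M) (I : Ideal R) (N : Submodule R M) (n : ℕ) :
    ℤ → AddSubgroup (QuotPow I N n) :=
  quotGrading ℳ (I ^ n • N)

/-- The grading of `I ^ (n - 1) N / I ^ n N`. -/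
abbrev grPowGrading (ℳ : ℤ → AddSubgroup M) (I : Ideal R) (N : Submodule R M) (n : ℕ) :
    ℤ → AddSubgroup (GrPow I N n) :=
  quotGrading (subGrading ℳ (I ^ (n - 1) • N)) ((I ^ n • N).submoduleOf (I ^ (n - 1) • N))

/-- The stable set `𝒜^M_N(I)` of associated primes of `M / I ^ n N`: the ideals that belong to
`Ass_R(M / I ^ n N)` for all `n ≫ 0`. -/
def stableA (I : Ideal R) (N : Submodule R M) : Set (Ideal R) :=
  {𝔭 | ∀ᶠ n : ℕ in atTop, 𝔭 ∈ associatedPrimes R (QuotPow I N n)}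

/-- The stable set `ℬ_N(I)` of associated primes of `I ^ (n - 1) N / I ^ n N`: the ideals that
belong to `Ass_R(I ^ (n - 1) N / I ^ n N)` for all `n ≫ 0`. -/
def stableB (I : Ideal R) (N : Submodule R M) : Set (Ideal R) :=
  {𝔭 | ∀ᶠ n : ℕ in atTop, 𝔭 ∈ associatedPrimes R (GrPow I N n)}

end VNumber

end

/-!
The two `v`-numbers are infima of sets of degrees: `annDegrees ℳ P K 𝔭` is the set of degrees of
homogeneous elements of `K` whose annihilator modulo `P` is `𝔭`, and one compares these sets for the
subquotients `M / I ^ n N`, `I ^ (n - 1) N / I ^ n N` and `(0 :_M I)`.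

*Comparison.* An element of `M / I ^ n N` with annihilator `𝔭 ⊇ I` is killed by `I`. By the
Artin-Rees lemma, for large `n` the submodule `(I ^ n N :_M I) / I ^ n N` is the direct sum of
`I ^ (n - 1) N / I ^ n N` and `(0 :_M I)`. As `𝔭` is prime, one of the two components of the element
has annihilator `𝔭` again, so the degrees for `M / I ^ n N` are those of the two summands
(`eventually_annDegrees_quotPow_eq`). If the generators of `I` have positive degrees, the first
summand lies in degrees that tend to infinity, and only the second one matters.

*Linearity.* Fix a prime `𝔭`. The submodules `{x ∈ I ^ n N | 𝔭 x ⊆ I ^ (n + 1) N}` form a stable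
`I`-filtration, hence for `n = n₀ + t` they are spanned by the products `y ^ α q` with `|α| = t` and
`q` in a finite set of homogeneous elements. The least degree of an element with annihilator `𝔭` is
attained by such a product. The exponents `α` for which `y ^ α q` has annihilator `𝔭` form a lower
set of `ℕ ^ c`, by Dickson's lemma a finite union of cones `β + ℕ ^ F`; on a cone, the minimum of
`∑ d i * α i` under the condition `|α| = t` is affine in `t` with slope `min_{i ∈ F} d i`. Finally,
a minimum of finitely many eventually affine functions is eventually affine. This gives
`eventuallyAffineMin_annDegrees`.

*Stability of associated primes.* The global `v`-numbers need that, for large `n`, all primes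
associated to `M / I ^ n N` belong to the stable set
(`eventually_associatedPrimes_quotPow_subset`). Only finitely many primes are associated to some
`I ^ n N / I ^ (n + 1) N`, being contractions from the Rees algebra, and by stability of the above
filtration each of them is eventually always or eventually never associated. With the exact
sequences `0 → I ^ n N / I ^ (n + 1) N → M / I ^ (n + 1) N → M / I ^ n N → 0` it follows that the
finite sets of primes associated to `M / I ^ n N` eventually decrease.

The passage from arbitrary to homogeneous elements rests on `isHomogeneous_of_mem_relAss` and
`annDegrees_nonempty`: associated primes of graded modules are homogeneous, and are annihilators of
homogeneous elements.
-/

namespace VNumber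

/-! ### Least elements that are eventually affine in a parameter -/

/-- For all large `t`, the set `S t` has a least element, which is an affine function of `t` with
slope in `D`; or `S t` is empty for all large `t`. -/
def EventuallyAffineMin (D : Set ℕ) (S : ℕ → Set ℤ) : Prop :=
  (∀ᶠ t in atTop, S t = ∅) ∨
    ∃ a ∈ D, ∃ b : ℤ, ∀ᶠ t : ℕ in atTop, IsLeast (S t) ((a : ℤ) * t + b)

theorem EventuallyAffineMin.congr {D : Set ℕ} {S T : ℕ → Set ℤ} (h : EventuallyAffineMin D S)
    (hST : ∀ᶠ t in atTop, S t = T t) : EventuallyAffineMin D T := by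
  rcases h with h | ⟨a, ha, b, h⟩
  · left
    filter_upwards [h, hST] with t h1 h2
    rw [← h2, h1]
  · refine Or.inr ⟨a, ha, b, ?_⟩
    filter_upwards [h, hST] with t h1 h2
    rwa [← h2]

/-- Two affine functions with natural slopes are eventually comparable. -/
theorem eventually_affine_le_or_ge (a a' : ℕ) (b b' : ℤ) :
    (∀ᶠ t : ℕ in atTop, (a : ℤ) * t + b ≤ a' * t + b') ∨
      ∀ᶠ t : ℕ in atTop, (a' : ℤ) * t + b' ≤ a * t + b := by
  have key : ∀ (a a' : ℕ) (b b' : ℤ), a < a' →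
      ∀ᶠ t : ℕ in atTop, (a : ℤ) * t + b ≤ a' * t + b' := by
    intro a a' b b' h
    filter_upwards [eventually_ge_atTop (b - b').toNat] with t ht
    have h1 : b - b' ≤ t := by omega
    have h2 : ((a : ℤ) + 1) * t ≤ a' * t := by
      have : (a : ℤ) + 1 ≤ a' := by exact_mod_cast h
      gcongr
    linarith
  rcases lt_trichotomy a a' with h | rfl | h
  · exact Or.inl (key _ _ _ _ h)
  · rcases le_total b b' with h | h
    · exact Or.inl (Eventually.of_forall fun t => by linarith)
    · exact Or.inr (Eventually.of_forall fun t => by linarith)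
  · exact Or.inr (key _ _ _ _ h)

theorem EventuallyAffineMin.union {D : Set ℕ} {S T : ℕ → Set ℤ} (hS : EventuallyAffineMin D S)
    (hT : EventuallyAffineMin D T) : EventuallyAffineMin D (fun t => S t ∪ T t) := by
  rcases hS with hS' | ⟨a, ha, b, hS'⟩
  · refine hT.congr ?_
    filter_upwards [hS'] with t h
    rw [h, Set.empty_union]
  rcases hT with hT' | ⟨a', ha', b', hT'⟩
  · refine EventuallyAffineMin.congr (Or.inr ⟨a, ha, b, hS'⟩) ?_
    filter_upwards [hT'] with t h
    rw [h, Set.union_empty]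
  right
  rcases eventually_affine_le_or_ge a a' b b' with h | h
  · refine ⟨a, ha, b, ?_⟩
    filter_upwards [h, hS', hT'] with t h1 h2 h3
    simpa [min_eq_left h1] using h2.union h3
  · refine ⟨a', ha', b', ?_⟩
    filter_upwards [h, hS', hT'] with t h1 h2 h3
    simpa [min_eq_right h1] using h2.union h3

theorem EventuallyAffineMin.biUnion {ι : Type*} {D : Set ℕ} {s : Set ι} (hs : s.Finite)
    {S : ι → ℕ → Set ℤ} (h : ∀ i ∈ s, EventuallyAffineMin D (S i)) :
    EventuallyAffineMin D (fun t => ⋃ i ∈ s, S i t) := by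
  induction s, hs using Set.Finite.induction_on with
  | empty => exact Or.inl (by simp)
  | @insert a s _ _ ih =>
    simp only [Set.biUnion_insert]
    exact (h a (by simp)).union (ih fun i hi => h i (by simp [hi]))

theorem EventuallyAffineMin.of_subset {D : Set ℕ} {S T : ℕ → Set ℤ} (h : EventuallyAffineMin D S)
    (hsub : ∀ t, S t ⊆ T t) (hlow : ∀ t, ∀ z ∈ T t, ∃ w ∈ S t, w ≤ z) :
    EventuallyAffineMin D T := by
  rcases h with h | ⟨a, ha, b, h⟩
  · left
    filter_upwards [h] with t ht
    rw [Set.eq_empty_iff_forall_notMem] at ht ⊢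
    intro z hz
    obtain ⟨w, hw, -⟩ := hlow t z hz
    exact ht w hw
  · refine Or.inr ⟨a, ha, b, ?_⟩
    filter_upwards [h] with t ht
    refine ⟨hsub t ht.1, fun z hz => ?_⟩
    obtain ⟨w, hw, hwz⟩ := hlow t z hz
    exact (ht.2 hw).trans hwz

theorem EventuallyAffineMin.of_add {D : Set ℕ} {S : ℕ → Set ℤ} (k : ℕ)
    (h : EventuallyAffineMin D fun t => S (t + k)) : EventuallyAffineMin D S := by
  rcases h with h | ⟨a, ha, b, h⟩
  · left
    rw [eventually_atTop] at h ⊢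
    obtain ⟨t₀, h⟩ := h
    refine ⟨t₀ + k, fun n hn => ?_⟩
    obtain ⟨t, rfl⟩ := Nat.exists_eq_add_of_le' (show k ≤ n by omega)
    exact h t (by omega)
  · refine Or.inr ⟨a, ha, b - a * k, ?_⟩
    rw [eventually_atTop] at h ⊢
    obtain ⟨t₀, h⟩ := h
    refine ⟨t₀ + k, fun n hn => ?_⟩
    obtain ⟨t, rfl⟩ := Nat.exists_eq_add_of_le' (show k ≤ n by omega)
    have h1 : (a : ℤ) * (t + k : ℕ) + (b - a * k) = a * t + b := by
      push_cast
      ring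
    rw [h1]
    exact h t (by omega)

theorem EventuallyAffineMin.resolve_of_nonempty {D : Set ℕ} {S : ℕ → Set ℤ}
    (h : EventuallyAffineMin D S) (hne : ∀ᶠ t in atTop, (S t).Nonempty) :
    ∃ a ∈ D, ∃ b : ℤ, ∀ᶠ t : ℕ in atTop, IsLeast (S t) ((a : ℤ) * t + b) := by
  refine h.resolve_left fun h' => ?_
  obtain ⟨t, h1, h2⟩ := (h'.and hne).exists
  exact h2.ne_empty h1

/-! ### Lower sets of exponents -/

section Exponents

/-- The cone `β + ℕ ^ F` of exponents that agree with `β` outside `F` and are at least `β`. -/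
def cone {ι : Type*} (β : ι → ℕ) (F : Set ι) : Set (ι → ℕ) :=
  {α | β ≤ α ∧ ∀ i ∉ F, α i = β i}

/-- The set of weights `∑ d i * α i + e` of the exponents `α ∈ E` of total degree `t`. -/
def weights {ι : Type*} [Fintype ι] (d : ι → ℕ) (e : ℤ) (E : Set (ι → ℕ)) (t : ℕ) : Set ℤ :=
  {z | ∃ α ∈ E, ∑ i, α i = t ∧ z = ∑ i, (d i : ℤ) * α i + e}

theorem eventuallyAffineMin_weights_cone {ι : Type*} [Fintype ι] (d : ι → ℕ) (e : ℤ)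
    (β : ι → ℕ) (F : Set ι) :
    EventuallyAffineMin (Set.range d) (weights d e (cone β F)) := by
  classical
  rcases F.eq_empty_or_nonempty with rfl | hF
  · left
    filter_upwards [eventually_gt_atTop (∑ i, β i)] with t ht
    rw [Set.eq_empty_iff_forall_notMem]
    rintro z ⟨α, ⟨-, hα⟩, rfl, -⟩
    exact ht.ne (Finset.sum_congr rfl fun i _ => (hα i (by simp)).symm)
  · -- The minimum is reached by spending all the available degree on a direction of least weight.
    obtain ⟨i₀, hi₀, hmin⟩ := F.toFinite.exists_minimalFor d F hF
    have hmin' : ∀ i ∈ F, d i₀ ≤ d i := fun i hi => by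
      rcases le_total (d i₀) (d i) with h | h
      · exact h
      · exact hmin hi h
    refine Or.inr ⟨d i₀, ⟨i₀, rfl⟩,
      ∑ i, (d i : ℤ) * β i - d i₀ * ∑ i, (β i : ℤ) + e, ?_⟩
    filter_upwards [eventually_ge_atTop (∑ i, β i)] with t ht
    constructor
    · refine ⟨β + Pi.single i₀ (t - ∑ i, β i), ⟨le_self_add, fun i hi => ?_⟩, ?_, ?_⟩
      · have : i ≠ i₀ := fun h => hi (h ▸ hi₀)
        simp [this]
      · simp only [Pi.add_apply, Finset.sum_add_distrib, Finset.sum_pi_single', Finset.mem_univ,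
          if_true]
        omega
      · have h1 : ∑ i, (d i : ℤ) * ((Pi.single i₀ (t - ∑ i, β i) : ι → ℕ) i : ℤ)
            = d i₀ * (t - ∑ i, (β i : ℤ)) := by
          rw [Finset.sum_eq_single i₀]
          · simp [Nat.cast_sub ht]
          · intro i _ hi
            simp [hi]
          · simp
        simp only [Pi.add_apply, Nat.cast_add, mul_add, Finset.sum_add_distrib, h1]
        ring
    · rintro z ⟨α, ⟨hβ, hα⟩, hsum, rfl⟩
      have h1 : ∑ i, (d i₀ : ℤ) * (α i - β i) ≤ ∑ i, (d i : ℤ) * (α i - β i) := by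
        refine Finset.sum_le_sum fun i _ => ?_
        by_cases hi : i ∈ F
        · have h2 : (β i : ℤ) ≤ α i := by exact_mod_cast hβ i
          have h3 : (d i₀ : ℤ) ≤ d i := by exact_mod_cast hmin' i hi
          exact mul_le_mul_of_nonneg_right h3 (by linarith)
        · simp [hα i hi]
      have h2 : ∑ i, (α i : ℤ) = t := by exact_mod_cast hsum
      rw [← Finset.mul_sum, Finset.sum_sub_distrib, h2] at h1
      simp only [mul_sub, Finset.sum_sub_distrib] at h1
      linarith

/-- Descending chains of lower sets in a well-quasi-order are stationary. -/
theorem exists_forall_ge_eq_of_antitone_lowerSet {α : Type*} [Preorder α] [WellQuasiOrderedLE α]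
    (s : ℕ → Set α) (hs : Antitone s) (hl : ∀ t, IsLowerSet (s t)) :
    ∃ t₀, ∀ t ≥ t₀, s t = s t₀ := by
  by_contra! h
  have h' : ∀ t₀, ∃ t, t₀ ≤ t ∧ ∃ x ∈ s t₀, x ∉ s t := fun t₀ => by
    obtain ⟨t, ht, hne⟩ := h t₀
    exact ⟨t, ht, Set.not_subset.1 fun hsub => hne ((hs ht).antisymm hsub)⟩
  choose g hg x hx hxg using h'
  obtain ⟨m, n, hmn, hle⟩ := WellQuasiOrderedLE.wqo (α := α) fun k => x (g^[k] 0)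
  have hmono : Monotone fun k => g^[k] 0 := monotone_nat_of_le_succ fun k => by
    simp only [Function.iterate_succ_apply']
    exact hg _
  have h1 : x (g^[n] 0) ∈ s (g^[m + 1] 0) := hs (hmono hmn) (hx _)
  rw [Function.iterate_succ_apply'] at h1
  exact hxg _ (hl _ hle h1)

/-- A lower set of `ℕ ^ c` is a finite union of cones `β + ℕ ^ F`. -/
theorem exists_finite_eq_biUnion_cone (c : ℕ) (E : Set (Fin c → ℕ)) (hE : IsLowerSet E) :
    ∃ D : Set ((Fin c → ℕ) × Set (Fin c)), D.Finite ∧ E = ⋃ p ∈ D, cone p.1 p.2 := by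
  induction c with
  | zero =>
    rcases E.eq_empty_or_nonempty with rfl | ⟨α, hα⟩
    · exact ⟨∅, Set.finite_empty, by simp⟩
    · refine ⟨{(α, ∅)}, Set.finite_singleton _, ?_⟩
      ext γ
      simp [cone, Subsingleton.elim γ α, hα]
  | succ c ih =>
    let s : ℕ → Set (Fin c → ℕ) := fun t => {α | (Fin.cons t α : Fin (c + 1) → ℕ) ∈ E}
    have hle : ∀ (t u : ℕ) (α β : Fin c → ℕ),
        (Fin.cons t α : Fin (c + 1) → ℕ) ≤ Fin.cons u β ↔ t ≤ u ∧ α ≤ β := fun _ _ _ _ =>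
      Fin.cons_le_cons
    have hl : ∀ t, IsLowerSet (s t) := fun t α β h hα => hE ((hle _ _ _ _).2 ⟨le_rfl, h⟩) hα
    have hs : Antitone s := fun t t' h α hα => hE ((hle _ _ _ _).2 ⟨h, le_rfl⟩) hα
    obtain ⟨t₀, ht₀⟩ := exists_forall_ge_eq_of_antitone_lowerSet s hs hl
    choose D hfin hD using fun t => ih (s t) (hl t)
    let f : ℕ → (Fin c → ℕ) × Set (Fin c) → (Fin (c + 1) → ℕ) × Set (Fin (c + 1)) :=
      fun t p => (Fin.cons t p.1, Fin.succ '' p.2)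
    let g : (Fin c → ℕ) × Set (Fin c) → (Fin (c + 1) → ℕ) × Set (Fin (c + 1)) :=
      fun p => (Fin.cons t₀ p.1, insert 0 (Fin.succ '' p.2))
    refine ⟨(⋃ t ∈ Set.Iio t₀, f t '' D t) ∪ g '' D t₀,
      ((Set.finite_Iio t₀).biUnion fun t _ => (hfin t).image _).union ((hfin t₀).image _), ?_⟩
    have hmem : ∀ t α, (Fin.cons t α : Fin (c + 1) → ℕ) ∈ E ↔ ∃ p ∈ D t, α ∈ cone p.1 p.2 := by
      intro t α
      have h := Set.ext_iff.1 (hD t) α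
      simp only [Set.mem_iUnion, exists_prop] at h
      exact h
    have hcone : ∀ (t u : ℕ) (α β : Fin c → ℕ) (F : Set (Fin c)),
        (Fin.cons u α : Fin (c + 1) → ℕ) ∈ cone (Fin.cons t β : Fin (c + 1) → ℕ) (Fin.succ '' F)
          ↔ u = t ∧ α ∈ cone β F := by
      intro t u α β F
      simp only [cone, Set.mem_ofPred_eq, hle, Fin.forall_fin_succ, Fin.cons_zero,
        Fin.cons_succ, Set.mem_image, Fin.succ_inj, exists_eq_right]
      constructor
      · rintro ⟨⟨-, h1⟩, h2, h3⟩
        exact ⟨h2 (by rintro ⟨i, -, hi⟩; exact Fin.succ_ne_zero i hi), h1, h3⟩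
      · rintro ⟨rfl, h1, h2⟩
        exact ⟨⟨le_rfl, h1⟩, fun _ => rfl, h2⟩
    have hcone' : ∀ (t u : ℕ) (α β : Fin c → ℕ) (F : Set (Fin c)),
        (Fin.cons u α : Fin (c + 1) → ℕ) ∈
            cone (Fin.cons t β : Fin (c + 1) → ℕ) (insert 0 (Fin.succ '' F))
          ↔ t ≤ u ∧ α ∈ cone β F := by
      intro t u α β F
      simp only [cone, Set.mem_ofPred_eq, hle, Fin.forall_fin_succ, Fin.cons_zero, Fin.cons_succ,
        Set.mem_insert_iff, Set.mem_image, Fin.succ_inj, exists_eq_right, Fin.succ_ne_zero,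
        true_or, not_true_eq_false, false_or, false_implies, true_and, and_assoc]
    ext γ
    obtain ⟨u, α, rfl⟩ : ∃ u α, γ = Fin.cons u α := ⟨γ 0, Fin.tail γ, (Fin.cons_self_tail γ).symm⟩
    simp only [Set.mem_iUnion, Set.mem_union, Set.mem_image, Set.mem_Iio, exists_prop]
    constructor
    · intro h
      rcases lt_or_ge u t₀ with hu | hu
      · obtain ⟨p, hp, hα⟩ := (hmem u α).1 h
        exact ⟨_, Or.inl ⟨u, hu, p, hp, rfl⟩, (hcone _ _ _ _ _).2 ⟨rfl, hα⟩⟩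
      · have h' : α ∈ s t₀ := by rw [← ht₀ u hu]; exact h
        obtain ⟨p, hp, hα⟩ := (hmem t₀ α).1 h'
        exact ⟨_, Or.inr ⟨p, hp, rfl⟩, (hcone' _ _ _ _ _).2 ⟨hu, hα⟩⟩
    · rintro ⟨_, ⟨t, -, p, hp, rfl⟩ | ⟨p, hp, rfl⟩, hγ⟩
      · obtain ⟨rfl, hα⟩ := (hcone _ _ _ _ _).1 hγ
        exact (hmem u α).2 ⟨p, hp, hα⟩
      · obtain ⟨hu, hα⟩ := (hcone' _ _ _ _ _).1 hγ
        have h' : α ∈ s t₀ := (hmem t₀ α).2 ⟨p, hp, hα⟩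
        rw [← ht₀ u hu] at h'
        exact h'

theorem eventuallyAffineMin_weights {c : ℕ} (d : Fin c → ℕ) (e : ℤ) (E : Set (Fin c → ℕ))
    (hE : IsLowerSet E) : EventuallyAffineMin (Set.range d) (weights d e E) := by
  obtain ⟨D, hfin, rfl⟩ := exists_finite_eq_biUnion_cone c E hE
  refine (EventuallyAffineMin.biUnion hfin fun p _ =>
    eventuallyAffineMin_weights_cone d e p.1 p.2).congr (Eventually.of_forall fun t => ?_)
  ext z
  simp only [weights, Set.mem_iUnion, Set.mem_ofPred_eq, exists_prop]
  constructor
  · rintro ⟨p, hp, α, hα, h⟩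
    exact ⟨α, ⟨p, hp, hα⟩, h⟩
  · rintro ⟨α, ⟨p, hp, hα⟩, h⟩
    exact ⟨p, hp, α, hα, h⟩

end Exponents

/-! ### Associated primes of subquotients -/

section Colon

variable {R : Type*} [CommRing R] {M : Type*} [AddCommGroup M] [Module R M]

/-- The submodule `(P :_M J) = {x | J x ⊆ P}` of `M`. -/
def modColon (P : Submodule R M) (J : Ideal R) : Submodule R M where
  carrier := {x | ∀ a ∈ J, a • x ∈ P}
  add_mem' hx hy a ha := by
    rw [smul_add]
    exact P.add_mem (hx a ha) (hy a ha)
  zero_mem' a _ := by simp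
  smul_mem' r x hx a ha := by
    rw [smul_comm]
    exact P.smul_mem r (hx a ha)

theorem smul_modColon_le (P : Submodule R M) (J : Ideal R) : J • modColon P J ≤ P :=
  Submodule.smul_le.2 fun _ ha _ hx => hx _ ha

theorem smul_modColon_le_modColon (P : Submodule R M) (I J : Ideal R) :
    I • modColon P J ≤ modColon (I • P) J :=
  Submodule.smul_le.2 fun r hr x hx a ha => by
    rw [smul_comm]
    exact Submodule.smul_mem_smul hr (hx a ha)

/-- The elements `x` of `M` that become `0` in the localization of `M / P` at `𝔭`. -/
def saturation (P : Submodule R M) (𝔭 : Ideal R) [h𝔭 : 𝔭.IsPrime] : Submodule R M where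
  carrier := {x | ∃ s ∉ 𝔭, s • x ∈ P}
  add_mem' := by
    rintro x y ⟨s, hs, hx⟩ ⟨t, ht, hy⟩
    refine ⟨s * t, fun h => (h𝔭.mem_or_mem h).elim hs ht, ?_⟩
    rw [smul_add]
    refine P.add_mem ?_ ?_
    · rw [mul_comm, mul_smul]
      exact P.smul_mem t hx
    · rw [mul_smul]
      exact P.smul_mem s hy
  zero_mem' := ⟨1, h𝔭.one_notMem, by simp⟩
  smul_mem' := by
    rintro r x ⟨s, hs, hx⟩
    refine ⟨s, hs, ?_⟩
    rw [smul_comm]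
    exact P.smul_mem r hx

theorem smul_saturation_le (P : Submodule R M) (I 𝔭 : Ideal R) [𝔭.IsPrime] :
    I • saturation P 𝔭 ≤ saturation (I • P) 𝔭 :=
  Submodule.smul_le.2 fun r hr x ⟨s, hs, hx⟩ => ⟨s, hs, by
    rw [smul_comm]
    exact Submodule.smul_mem_smul hr hx⟩

/-- A prime `𝔭` is the annihilator of `x` modulo `P` if and only if `𝔭` kills `x` modulo `P` and
`x` survives in the localization at `𝔭`. As the two conditions define submodules, this lets the
property be tested on the terms of a sum. -/
theorem eq_colon_singleton_iff {P : Submodule R M} {𝔭 : Ideal R} [𝔭.IsPrime] {x : M} :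
    𝔭 = P.colon {x} ↔ x ∈ modColon P 𝔭 ∧ x ∉ saturation P 𝔭 := by
  constructor
  · intro h
    refine ⟨fun a ha => ?_, ?_⟩
    · rw [h] at ha
      exact Submodule.mem_colon_singleton.1 ha
    · rintro ⟨s, hs, hx⟩
      exact hs (h ▸ Submodule.mem_colon_singleton.2 hx)
  · rintro ⟨h1, h2⟩
    refine le_antisymm (fun a ha => Submodule.mem_colon_singleton.2 (h1 a ha)) fun a ha => ?_
    by_contra hna
    exact h2 ⟨a, hna, Submodule.mem_colon_singleton.1 ha⟩

/-- The associated primes of the subquotient `(K + P) / P` of `M`, for Noetherian `R`. -/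
def relAss (P K : Submodule R M) : Set (Ideal R) :=
  {𝔭 | 𝔭.IsPrime ∧ ∃ x ∈ K, 𝔭 = P.colon {x}}

theorem mem_associatedPrimes_iff_mem_relAss [IsNoetherianRing R] {P K : Submodule R M}
    {Q : Type*} [AddCommGroup Q] [Module R Q] (f : K →ₗ[R] Q) (hf : Function.Surjective f)
    (hker : ∀ x, f x = 0 ↔ (x : M) ∈ P) {𝔭 : Ideal R} :
    𝔭 ∈ associatedPrimes R Q ↔ 𝔭 ∈ relAss P K := by
  have key : ∀ x : K, (⊥ : Submodule R Q).colon {f x} = P.colon {(x : M)} := fun x => by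
    ext a
    rw [Submodule.mem_colon_singleton, Submodule.mem_colon_singleton, Submodule.mem_bot,
      ← map_smul, hker]
    rfl
  rw [AssociatedPrimes.mem_iff, isAssociatedPrime_iff]
  refine and_congr_right fun _ => ?_
  rw [hf.exists]
  simp only [key, Subtype.exists, exists_prop]

theorem mem_associatedPrimes_submoduleOf_iff [IsNoetherianRing R] {P K : Submodule R M}
    {𝔭 : Ideal R} : 𝔭 ∈ associatedPrimes R (K ⧸ P.submoduleOf K) ↔ 𝔭 ∈ relAss P K :=
  mem_associatedPrimes_iff_mem_relAss (P.submoduleOf K).mkQ (Submodule.mkQ_surjective _)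
    (fun x => by
      rw [Submodule.mkQ_apply, Submodule.Quotient.mk_eq_zero]
      rfl)

theorem mem_associatedPrimes_quotPow_iff [IsNoetherianRing R] {I : Ideal R} {N : Submodule R M}
    {n : ℕ} {𝔭 : Ideal R} :
    𝔭 ∈ associatedPrimes R (QuotPow I N n) ↔ 𝔭 ∈ relAss (I ^ n • N) ⊤ :=
  mem_associatedPrimes_iff_mem_relAss ((I ^ n • N).mkQ ∘ₗ (⊤ : Submodule R M).subtype)
    (fun x => by
      obtain ⟨m, rfl⟩ := (I ^ n • N).mkQ_surjective x
      exact ⟨⟨m, trivial⟩, rfl⟩)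
    (fun x => by simp)

theorem mem_associatedPrimes_grPow_iff [IsNoetherianRing R] {I : Ideal R} {N : Submodule R M}
    {n : ℕ} {𝔭 : Ideal R} :
    𝔭 ∈ associatedPrimes R (GrPow I N n) ↔ 𝔭 ∈ relAss (I ^ n • N) (I ^ (n - 1) • N) :=
  mem_associatedPrimes_submoduleOf_iff

theorem mem_associatedPrimes_submodule_iff [IsNoetherianRing R] {K : Submodule R M}
    {𝔭 : Ideal R} : 𝔭 ∈ associatedPrimes R K ↔ 𝔭 ∈ relAss ⊥ K :=
  mem_associatedPrimes_iff_mem_relAss LinearMap.id Function.surjective_id (fun x => by simp)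

theorem relAss_mono_right (P : Submodule R M) {K K' : Submodule R M} (h : K ≤ K') :
    relAss P K ⊆ relAss P K' :=
  fun _ ⟨hp, x, hx, hpx⟩ => ⟨hp, x, h hx, hpx⟩

/-- For `P ≤ P'`, the associated primes of `M / P` are among those of `M / P'` and `P' / P`. -/
theorem relAss_top_subset_union {P P' : Submodule R M} (h : P ≤ P') :
    relAss P ⊤ ⊆ relAss P' ⊤ ∪ relAss P P' := by
  rintro 𝔭 ⟨hp, x, -, hpx⟩
  rw [eq_colon_singleton_iff] at hpx
  by_cases hs : x ∈ saturation P' 𝔭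
  · obtain ⟨s, hs, hx⟩ := hs
    refine Or.inr ⟨hp, s • x, hx, eq_colon_singleton_iff.2
      ⟨(modColon P 𝔭).smul_mem s hpx.1, ?_⟩⟩
    rintro ⟨t, ht, htx⟩
    refine hpx.2 ⟨t * s, fun h => (hp.mem_or_mem h).elim ht hs, ?_⟩
    rwa [mul_smul]
  · exact Or.inl ⟨hp, x, trivial, eq_colon_singleton_iff.2 ⟨fun a ha => h (hpx.1 a ha), hs⟩⟩

theorem mem_colonZero {I : Ideal R} {x : M} : x ∈ colonZero M I ↔ ∀ a ∈ I, a • x = 0 := by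
  simp [Submodule.mem_torsionBySet_iff]

end Colon

/-! ### Consequences of the Artin-Rees lemma -/

section ArtinRees

variable {R : Type*} [CommRing R] {M : Type*} [AddCommGroup M] [Module R M]

theorem pow_succ_smul_eq (I : Ideal R) (N : Submodule R M) (n : ℕ) :
    I ^ (n + 1) • N = I • I ^ n • N := by
  rw [pow_succ', mul_smul]

theorem pow_succ_smul_le (I : Ideal R) (N : Submodule R M) (n : ℕ) :
    I ^ (n + 1) • N ≤ I ^ n • N := by
  rw [pow_succ_smul_eq]
  exact Submodule.smul_le_right

/-- The `I`-filtration with terms `{x ∈ I ^ n N | J x ⊆ I ^ (n + 1) N}`. -/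
def annFiltration (I J : Ideal R) (N : Submodule R M) : I.Filtration M where
  N n := I ^ n • N ⊓ modColon (I ^ (n + 1) • N) J
  mono n := inf_le_inf (pow_succ_smul_le I N n) fun _ hx a ha => pow_succ_smul_le I N _ (hx a ha)
  smul_le n := by
    refine le_inf ?_ ?_
    · rw [pow_succ_smul_eq]
      exact smul_mono_right _ inf_le_left
    · rw [pow_succ_smul_eq I N (n + 1)]
      exact (smul_mono_right _ inf_le_right).trans (smul_modColon_le_modColon _ _ _)

theorem mem_smul_pi {ι : Type*} [Fintype ι] (J : Ideal R) (N : Submodule R M) {v : ι → M}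
    (hv : ∀ i, v i ∈ J • N) : v ∈ J • Submodule.pi Set.univ fun _ : ι => N := by
  classical
  have h1 : v = ∑ i, LinearMap.single R (fun _ : ι => M) i (v i) := by
    simp [LinearMap.single_apply, Finset.univ_sum_single]
  rw [h1]
  refine Submodule.sum_mem _ fun i _ => ?_
  have h2 : (J • N).map (LinearMap.single R (fun _ : ι => M) i)
      ≤ J • Submodule.pi Set.univ fun _ : ι => N := by
    rw [Submodule.map_smul'']
    refine smul_mono_right _ ?_
    rintro _ ⟨x, hx, rfl⟩ j -
    by_cases h : j = i
    · subst h
      simpa using hx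
    · simp [h]
  exact h2 ⟨_, hv i, rfl⟩

variable [IsNoetherianRing R] [Module.Finite R M]

theorem annFiltration_stable (I J : Ideal R) (N : Submodule R M) : (annFiltration I J N).Stable :=
  (I.stableFiltration_stable N).of_le fun _ => inf_le_left

theorem eventually_pow_smul_inf_colonZero_eq_bot (I : Ideal R) (N : Submodule R M) :
    ∀ᶠ n in atTop, I ^ n • N ⊓ colonZero M I = ⊥ := by
  obtain ⟨n₀, h⟩ := (I.stableFiltration_stable N).inter_right (I.trivialFiltration (colonZero M I))
  filter_upwards [eventually_gt_atTop n₀] with n hn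
  obtain ⟨k, rfl⟩ := Nat.exists_eq_add_of_lt hn
  have h1 := h (n₀ + k) (by omega)
  change I • (I ^ (n₀ + k) • N ⊓ colonZero M I) = I ^ (n₀ + k + 1) • N ⊓ colonZero M I at h1
  rw [← h1, eq_bot_iff]
  exact Submodule.smul_le.2 fun r hr x hx => (mem_colonZero.1 hx.2) r hr

/-- For large `n` one has `(I ^ (n + 1) N :_M I) = I ^ n N + (0 :_M I)`: apply the Artin-Rees
lemma to the image of `M` under multiplication by a finite system of generators of `I`. -/
theorem eventually_modColon_pow_le (I : Ideal R) (N : Submodule R M) :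
    ∀ᶠ n in atTop, modColon (I ^ (n + 1) • N) I ≤ I ^ n • N ⊔ colonZero M I := by
  obtain ⟨c, y, hy⟩ := Submodule.fg_iff_exists_fin_generating_family.1 (IsNoetherian.noetherian I)
  let φ : M →ₗ[R] (Fin c → M) := LinearMap.pi fun i => LinearMap.lsmul R M (y i)
  have hyI : ∀ i, y i ∈ I := fun i => hy ▸ Submodule.subset_span ⟨i, rfl⟩
  have hker : ∀ x, φ x = 0 → x ∈ colonZero M I := fun x hx => mem_colonZero.2 fun a ha => by
    have h1 : I ≤ LinearMap.ker (LinearMap.toSpanSingleton R M x) := by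
      rw [← hy, Submodule.span_le]
      rintro _ ⟨i, rfl⟩
      exact congrFun hx i
    exact h1 ha
  let F : I.Filtration (Fin c → M) :=
    { N := fun n => (modColon (I ^ (n + 1) • N) I).map φ
      mono := fun n => Submodule.map_mono fun x hx a ha => pow_succ_smul_le I N _ (hx a ha)
      smul_le := fun n => by
        rw [← Submodule.map_smul'', pow_succ_smul_eq I N (n + 1)]
        exact Submodule.map_mono (smul_modColon_le_modColon _ _ _) }
  have hF : F.Stable := by
    refine (I.stableFiltration_stable (Submodule.pi Set.univ fun _ : Fin c => N)).of_le ?_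
    rintro n _ ⟨x, hx, rfl⟩
    exact mem_smul_pi _ _ fun i => pow_succ_smul_le I N n (hx _ (hyI i))
  obtain ⟨n₀, h⟩ := hF
  filter_upwards [eventually_gt_atTop n₀] with n hn x hx
  obtain ⟨k, rfl⟩ := Nat.exists_eq_add_of_lt hn
  have h1 : I • (modColon (I ^ (n₀ + k + 1) • N) I).map φ
    = (modColon (I ^ (n₀ + k + 1 + 1) • N) I).map φ := h (n₀ + k) (by omega)
  have h2 : φ x ∈ (I • modColon (I ^ (n₀ + k + 1) • N) I).map φ := by
    rw [Submodule.map_smul'', h1]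
    exact ⟨x, hx, rfl⟩
  obtain ⟨u, hu, hux⟩ := h2
  rw [← add_sub_cancel u x]
  refine Submodule.add_mem_sup (smul_modColon_le _ _ hu) (hker _ ?_)
  rw [map_sub, hux, sub_self]

/-- For a fixed prime `𝔭`, the set of all large `n` such that `𝔭` is associated to
`I ^ n N / I ^ (n + 1) N` is closed under predecessors: the elements of `I ^ (n + 1) N` killed by
`𝔭` are combinations of such elements of `I ^ n N`, so if the latter vanish at `𝔭`, so do the
former. -/
theorem eventually_mem_relAss_of_succ (I : Ideal R) (N : Submodule R M) (𝔭 : Ideal R) :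
    ∀ᶠ n in atTop, 𝔭 ∈ relAss (I ^ (n + 2) • N) (I ^ (n + 1) • N) →
      𝔭 ∈ relAss (I ^ (n + 1) • N) (I ^ n • N) := by
  obtain ⟨n₀, h⟩ := annFiltration_stable I 𝔭 N
  filter_upwards [eventually_ge_atTop n₀] with n hn
  rintro ⟨hp, x, hx, hpx⟩
  rw [eq_colon_singleton_iff] at hpx
  have h1 : x ∈ I • (annFiltration I 𝔭 N).N n := by
    rw [h n hn]
    exact ⟨hx, hpx.1⟩
  by_contra hcon
  refine hpx.2 ?_
  rw [pow_succ_smul_eq]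
  have h2 : (annFiltration I 𝔭 N).N n ≤ saturation (I ^ (n + 1) • N) 𝔭 := fun z hz => by
    by_contra hzs
    exact hcon ⟨hp, z, hz.1, eq_colon_singleton_iff.2 ⟨hz.2, hzs⟩⟩
  exact smul_saturation_le _ _ _ (smul_mono_right I h2 h1)

end ArtinRees

/-! ### Asymptotic stability of associated primes -/

section Brodmann

/-- Let `A` be a Noetherian `R`-algebra and `w` an element of an `A`-module whose annihilator in
`R` is the prime `𝔭`. Among the annihilators in `A` of such elements, a maximal one is prime; so
`𝔭` is the contraction of an associated prime over `A`. -/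
theorem exists_associatedPrime_comap_eq {R A Q : Type*} [CommRing R] [CommRing A] [Algebra R A]
    [IsNoetherianRing A] [AddCommGroup Q] [Module A Q] {𝔭 : Ideal R} (h𝔭 : 𝔭.IsPrime) (w : Q)
    (hw : ∀ r, r ∈ 𝔭 ↔ algebraMap R A r • w = 0) :
    ∃ P ∈ associatedPrimes A Q, P.comap (algebraMap R A) = 𝔭 := by
  obtain ⟨_, ⟨v, hv, rfl⟩, hmax⟩ := set_has_maximal_iff_noetherian.2 ‹IsNoetherianRing A›
    {J | ∃ v : Q, (∀ r, r ∈ 𝔭 ↔ algebraMap R A r • v = 0) ∧ J = (⊥ : Submodule A Q).colon {v}}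
    ⟨_, w, hw, rfl⟩
  have hmem : ∀ (u : Q) (a : A), a ∈ (⊥ : Submodule A Q).colon {u} ↔ a • u = 0 := fun u a => by
    rw [Submodule.mem_colon_singleton, Submodule.mem_bot]
  -- If `b` kills a multiple `s • v` with `s ∉ 𝔭`, then it kills `v`, by maximality.
  have hcancel : ∀ (b : A) (s : R), s ∉ 𝔭 → algebraMap R A s • b • v = 0 → b • v = 0 := by
    intro b s hs hb
    have h1 : ∀ r, r ∈ 𝔭 ↔ algebraMap R A r • algebraMap R A s • v = 0 := fun r => by
      rw [← mul_smul, ← map_mul, ← hv]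
      exact ⟨fun h => 𝔭.mul_mem_right s h, fun h => (h𝔭.mem_or_mem h).resolve_right hs⟩
    have h2 := hmax _ ⟨_, h1, rfl⟩
    by_contra hbv
    refine h2 (lt_of_le_of_ne (fun a ha => ?_) fun heq => hbv ?_)
    · rw [hmem] at ha ⊢
      rw [smul_comm, ha, smul_zero]
    · rw [← hmem, heq, hmem, smul_comm, hb]
  refine ⟨_, isAssociatedPrime_iff.2 ⟨⟨?_, ?_⟩, v, rfl⟩, ?_⟩
  · rw [Ne, Ideal.eq_top_iff_one, hmem, one_smul]
    rintro rfl
    exact h𝔭.one_notMem ((hv 1).2 (smul_zero _))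
  · intro a b hab
    rw [hmem, mul_smul] at hab
    simp only [hmem]
    by_cases hb : b • v = 0
    · exact Or.inr hb
    left
    by_contra hav
    have h1 : ∀ r, r ∈ 𝔭 ↔ algebraMap R A r • b • v = 0 := fun r => by
      refine ⟨fun h => ?_, fun h => ?_⟩
      · rw [smul_comm, (hv r).1 h, smul_zero]
      · by_contra hr
        exact hb (hcancel b r hr h)
    refine hmax _ ⟨_, h1, rfl⟩ (lt_of_le_of_ne (fun c hc => ?_) fun heq => hav ?_)
    · rw [hmem] at hc ⊢
      rw [smul_comm, hc, smul_zero]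
    · rw [← hmem, heq, hmem, hab]
  · ext r
    rw [Ideal.mem_comap, hmem, hv]

theorem exists_mem_relAss_comap_eq {R A E : Type*} [CommRing R] [CommRing A] [Algebra R A]
    [IsNoetherianRing A] [AddCommGroup E] [Module A E] {P K : Submodule A E} {𝔭 : Ideal R}
    (h𝔭 : 𝔭.IsPrime) {w : E} (hwK : w ∈ K) (hw : ∀ r, r ∈ 𝔭 ↔ algebraMap R A r • w ∈ P) :
    ∃ 𝔮 ∈ relAss P K, 𝔮.comap (algebraMap R A) = 𝔭 := by
  obtain ⟨𝔮, h𝔮, h⟩ := exists_associatedPrime_comap_eq h𝔭 ((P.submoduleOf K).mkQ ⟨w, hwK⟩)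
    fun r => by
      rw [hw, ← map_smul, Submodule.mkQ_apply, Submodule.Quotient.mk_eq_zero]
      rfl
  exact ⟨𝔮, mem_associatedPrimes_submoduleOf_iff.1 h𝔮, h⟩

theorem finite_relAss {A E : Type*} [CommRing A] [IsNoetherianRing A] [AddCommGroup E] [Module A E]
    (P : Submodule A E) {K : Submodule A E} (hK : K.FG) : (relAss P K).Finite := by
  have : Module.Finite A K := Module.Finite.iff_fg.2 hK
  exact (associatedPrimes.finite A (K ⧸ P.submoduleOf K)).subset
    fun _ h => mem_associatedPrimes_submoduleOf_iff.2 h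

variable {R : Type*} [CommRing R] [IsNoetherianRing R] {M : Type*} [AddCommGroup M] [Module R M]
  [Module.Finite R M]

/-- Only finitely many primes are associated to some `I ^ n N / I ^ (n + 1) N`: they are
contractions of associated primes of the module `⨁ I ^ n N / I ^ (n + 1) N` over the Rees
algebra. -/
theorem finite_iUnion_relAss_pow (I : Ideal R) (N : Submodule R M) :
    (⋃ n : ℕ, relAss (I ^ (n + 1) • N) (I ^ n • N)).Finite := by
  have hfg : (I.stableFiltration N).submodule.FG :=
    (Ideal.Filtration.submodule_fg_iff_stable _ fun i => IsNoetherian.noetherian _).2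
      (I.stableFiltration_stable N)
  refine ((finite_relAss (I.stableFiltration (I • N)).submodule hfg).image
    (Ideal.comap (algebraMap R (reesAlgebra I)))).subset ?_
  rintro 𝔭 h
  obtain ⟨n, hp, x, hx, hpx⟩ := Set.mem_iUnion.1 h
  have hw : PolynomialModule.single R n x ∈ (I.stableFiltration N).submodule := by
    intro i
    rw [PolynomialModule.coeff_single, Finsupp.single_apply]
    split_ifs with h
    · subst h
      exact hx
    · exact Submodule.zero_mem _
  refine exists_mem_relAss_comap_eq hp hw fun r => ?_
  have h1 : algebraMap R (reesAlgebra I) r • PolynomialModule.single R n x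
      = PolynomialModule.single R n (r • x) := by
    change Polynomial.monomial 0 r • PolynomialModule.single R n x = _
    rw [PolynomialModule.monomial_smul_single, zero_add]
  rw [hpx, Submodule.mem_colon_singleton, h1, Ideal.Filtration.mem_submodule]
  have h2 : I ^ (n + 1) • N = I ^ n • I • N := by rw [pow_succ, mul_smul]
  rw [h2]
  constructor
  · intro h i
    rw [PolynomialModule.coeff_single, Finsupp.single_apply]
    split_ifs with hi
    · subst hi
      exact h
    · exact Submodule.zero_mem _
  · intro h
    simpa using h n

/-- The finite sets of primes associated to `M / I ^ n N` decrease for large `n`, so they are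
eventually contained in the stable set. -/
theorem eventually_associatedPrimes_quotPow_subset (I : Ideal R) (N : Submodule R M) :
    ∀ᶠ n in atTop, associatedPrimes R (QuotPow I N n) ⊆ stableA I N := by
  have h1 : ∀ᶠ n in atTop, relAss (I ^ (n + 2) • N) (I ^ (n + 1) • N) ⊆
      relAss (I ^ (n + 1) • N) (I ^ n • N) := by
    have := (Filter.eventually_all_finite (finite_iUnion_relAss_pow I N)).2
      fun 𝔭 _ => eventually_mem_relAss_of_succ I N 𝔭
    filter_upwards [this] with n hn 𝔭 hp
    exact hn 𝔭 (Set.mem_iUnion.2 ⟨n + 1, hp⟩) hp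
  obtain ⟨n₀, hn₀⟩ := eventually_atTop.1 h1
  have h2 : ∀ n ≥ n₀ + 1, associatedPrimes R (QuotPow I N (n + 1)) ⊆
      associatedPrimes R (QuotPow I N n) := by
    intro n hn 𝔭 hp
    obtain ⟨k, rfl⟩ := Nat.exists_eq_add_of_le' (show 1 ≤ n by omega)
    rw [mem_associatedPrimes_quotPow_iff] at hp ⊢
    rcases relAss_top_subset_union (pow_succ_smul_le I N _) hp with h | h
    · exact h
    · exact relAss_mono_right _ le_top (hn₀ k (by omega) h)
  have h3 : ∀ m ≥ n₀ + 1, ∀ n ≥ m, associatedPrimes R (QuotPow I N n) ⊆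
      associatedPrimes R (QuotPow I N m) := by
    intro m hm n hn
    induction n, hn using Nat.le_induction with
    | base => exact subset_rfl
    | succ n hn ih => exact (h2 n (by omega)).trans ih
  have h4 : ∀ 𝔭 ∈ associatedPrimes R (QuotPow I N (n₀ + 1)), ∀ᶠ n in atTop,
      𝔭 ∈ associatedPrimes R (QuotPow I N n) → 𝔭 ∈ stableA I N := by
    intro 𝔭 _
    by_cases h : 𝔭 ∈ stableA I N
    · exact Eventually.of_forall fun _ _ => h
    · obtain ⟨m, hm, hpm⟩ := (frequently_atTop.1 (not_eventually.1 h)) (n₀ + 1)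
      filter_upwards [eventually_ge_atTop m] with n hn hpn
      exact absurd (h3 m hm n hn hpn) hpm
  filter_upwards [(Filter.eventually_all_finite (associatedPrimes.finite R _)).2 h4,
    eventually_ge_atTop (n₀ + 1)] with n hn hle 𝔭 hp
  exact hn 𝔭 (h3 _ le_rfl n hle hp) hp

end Brodmann

/-! ### Homogeneous components and homogeneous submodules -/

theorem decompose_coe_of_mem {ι G : Type*} [DecidableEq ι] [AddCommGroup G] {𝒢 : ι → AddSubgroup G}
    [DirectSum.Decomposition 𝒢] {x : G} {j : ι} (hx : x ∈ 𝒢 j) (k : ι) :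
    (DirectSum.decompose 𝒢 x k : G) = if k = j then x else 0 := by
  split_ifs with h
  · rw [h, DirectSum.decompose_of_mem_same 𝒢 hx]
  · rw [DirectSum.decompose_of_mem_ne 𝒢 hx (Ne.symm h)]

section Graded

open scoped Classical

variable {R : Type*} [CommRing R] {M : Type*} [AddCommGroup M] [Module R M]
  {ℳ : ℤ → AddSubgroup M} [DirectSum.Decomposition ℳ]

theorem mem_of_forall_decompose_mem {P : Submodule R M} {x : M}
    (h : ∀ j, (DirectSum.decompose ℳ x j : M) ∈ P) : x ∈ P := by
  rw [← DirectSum.sum_support_decompose ℳ x]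
  exact P.sum_mem fun j _ => h j

theorem isHomogeneous_inf {P Q : Submodule R M} (hP : P.IsHomogeneous ℳ)
    (hQ : Q.IsHomogeneous ℳ) : (P ⊓ Q).IsHomogeneous ℳ :=
  fun i _ hx => ⟨hP i hx.1, hQ i hx.2⟩

theorem isHomogeneous_bot : (⊥ : Submodule R M).IsHomogeneous ℳ := fun i x hx => by
  rw [(Submodule.mem_bot R).1 hx]
  simp

theorem exists_finset_homogeneous_span_eq {P : Submodule R M} (hP : P.IsHomogeneous ℳ)
    (hfg : P.FG) :
    ∃ Q : Finset M, (∀ q ∈ Q, ∃ j, q ∈ ℳ j) ∧ Submodule.span R (Q : Set M) = P := by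
  classical
  obtain ⟨S, rfl⟩ := hfg
  refine ⟨S.biUnion fun x => (DirectSum.decompose ℳ x).support.image
    fun j => (DirectSum.decompose ℳ x j : M), fun q hq => ?_, le_antisymm ?_ ?_⟩
  · simp only [Finset.mem_biUnion, Finset.mem_image] at hq
    obtain ⟨x, -, j, -, rfl⟩ := hq
    exact ⟨j, (DirectSum.decompose ℳ x j).2⟩
  · refine Submodule.span_le.2 fun q hq => ?_
    simp only [Finset.coe_biUnion, Set.mem_iUnion, Finset.coe_image, Set.mem_image] at hq
    obtain ⟨x, hx, j, -, rfl⟩ := hq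
    exact hP j (Submodule.subset_span hx)
  · refine Submodule.span_le.2 fun x hx => ?_
    rw [SetLike.mem_coe, ← DirectSum.sum_support_decompose ℳ x]
    refine Submodule.sum_mem _ fun j hj => Submodule.subset_span ?_
    simp only [Finset.coe_biUnion, Set.mem_iUnion, Finset.coe_image, Set.mem_image]
    exact ⟨x, hx, j, hj, rfl⟩

variable {𝒜 : ℕ → AddSubgroup R}
  (hsmul : ∀ (i : ℕ) (j : ℤ) (r : R) (x : M), r ∈ 𝒜 i → x ∈ ℳ j → r • x ∈ ℳ ((i : ℤ) + j))

include hsmul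

theorem decompose_smul_of_mem {i : ℕ} {r : R} (hr : r ∈ 𝒜 i) (x : M) (k : ℤ) :
    (DirectSum.decompose ℳ (r • x) k : M) = r • (DirectSum.decompose ℳ x (k - i) : M) := by
  induction x using DirectSum.Decomposition.inductionOn ℳ with
  | zero => simp
  | @homogeneous j m =>
    rw [decompose_coe_of_mem (hsmul i j r m hr m.2), decompose_coe_of_mem m.2]
    by_cases h : k = i + j
    · rw [if_pos h, if_pos (by omega)]
    · rw [if_neg h, if_neg (by omega), smul_zero]
  | add m m' h h' => simp [h, h', smul_add]

variable [GradedRing 𝒜]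

theorem decompose_smul (a : R) (x : M) (k : ℤ) :
    (DirectSum.decompose ℳ (a • x) k : M) = ∑ i ∈ (DirectSum.decompose 𝒜 a).support,
      (DirectSum.decompose 𝒜 a i : R) • (DirectSum.decompose ℳ x (k - i) : M) := by
  conv_lhs => rw [← DirectSum.sum_support_decompose 𝒜 a, Finset.sum_smul,
    DirectSum.decompose_sum, DFinsupp.finsetSum_apply, AddSubmonoidClass.coe_finsetSum]
  exact Finset.sum_congr rfl fun i _ =>
    decompose_smul_of_mem hsmul (DirectSum.decompose 𝒜 a i).2 x k

theorem isHomogeneous_smul {J : Ideal R} (hJ : J.IsHomogeneous 𝒜) {P : Submodule R M}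
    (hP : P.IsHomogeneous ℳ) : (J • P).IsHomogeneous ℳ := by
  intro k x hx
  induction hx using Submodule.smul_induction_on' with
  | smul a ha m hm =>
    rw [decompose_smul hsmul]
    exact Submodule.sum_mem _ fun i _ => Submodule.smul_mem_smul (hJ i ha) (hP _ hm)
  | add x _ y _ hx hy =>
    rw [DirectSum.decompose_add, DirectSum.add_apply, AddSubgroup.coe_add]
    exact Submodule.add_mem _ hx hy

theorem isHomogeneous_pow_smul {J : Ideal R} (hJ : J.IsHomogeneous 𝒜) {P : Submodule R M}
    (hP : P.IsHomogeneous ℳ) (n : ℕ) : (J ^ n • P).IsHomogeneous ℳ := by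
  induction n with
  | zero => simpa using hP
  | succ n ih =>
    rw [pow_succ_smul_eq]
    exact isHomogeneous_smul hsmul hJ ih

theorem isHomogeneous_modColon {J : Ideal R} (hJ : J.IsHomogeneous 𝒜) {P : Submodule R M}
    (hP : P.IsHomogeneous ℳ) : (modColon P J).IsHomogeneous ℳ := by
  intro k x hx a ha
  rw [← DirectSum.sum_support_decompose 𝒜 a, Finset.sum_smul]
  refine P.sum_mem fun i _ => ?_
  have h1 := hP (k + i) (hx _ (hJ i ha))
  rwa [decompose_smul_of_mem hsmul (DirectSum.decompose 𝒜 a i).2, add_sub_cancel_right] at h1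

theorem isHomogeneous_colonZero {J : Ideal R} (hJ : J.IsHomogeneous 𝒜) :
    (colonZero M J).IsHomogeneous ℳ := fun k _ hx =>
  mem_colonZero.2 fun a ha => isHomogeneous_modColon hsmul hJ isHomogeneous_bot k
    (fun b hb => (Submodule.mem_bot R).2 (mem_colonZero.1 hx b hb)) a ha

/-- If `a` kills `x` modulo a homogeneous submodule, then so does some power of the component of
highest degree of `a`. -/
theorem exists_pow_smul_mem_of_smul_mem {P : Submodule R M} (hP : P.IsHomogeneous ℳ) {a : R} {t : ℕ}
    (ha : ∀ i > t, (DirectSum.decompose 𝒜 a i : R) = 0) {x : M} (hx : a • x ∈ P) :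
    ∃ n, (DirectSum.decompose 𝒜 a t : R) ^ n • x ∈ P := by
  set r : R := (DirectSum.decompose 𝒜 a t : R)
  have hbound : ∃ u l : ℤ, ∀ j, (j ≥ u ∨ j < l) → (DirectSum.decompose ℳ x j : M) = 0 := by
    obtain ⟨u, hu⟩ := (DirectSum.decompose ℳ x).support.bddAbove
    obtain ⟨l, hl⟩ := (DirectSum.decompose ℳ x).support.bddBelow
    refine ⟨u + 1, l, fun j hj => ?_⟩
    by_contra h
    have hmem : j ∈ (DirectSum.decompose ℳ x).support := by
      rw [DFinsupp.mem_support_iff]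
      exact fun h0 => h (by rw [h0]; rfl)
    have h1 := hu hmem
    have h2 := hl hmem
    omega
  obtain ⟨u, l, hul⟩ := hbound
  -- Descending induction: `r ^ n` moves the top `n` components of `x` into `P`.
  have key : ∀ n : ℕ, ∀ j ≥ u - n, r ^ n • (DirectSum.decompose ℳ x j : M) ∈ P := by
    intro n
    induction n with
    | zero =>
      intro j hj
      rw [hul j (Or.inl (by simpa using hj)), smul_zero]
      exact P.zero_mem
    | succ n ih =>
      intro j hj
      have h1 : r ^ n • (DirectSum.decompose ℳ (a • x) (j + t) : M) ∈ P :=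
        P.smul_mem _ (hP _ hx)
      rw [decompose_smul hsmul, Finset.smul_sum] at h1
      by_cases ht : t ∈ (DirectSum.decompose 𝒜 a).support
      · rw [← Finset.add_sum_erase _ _ ht] at h1
        have h2 := (P.add_mem_iff_left (P.sum_mem fun i hi => ?_)).1 h1
        · rwa [add_sub_cancel_right, ← mul_smul, ← pow_succ] at h2
        · rcases lt_or_gt_of_ne (Finset.ne_of_mem_erase hi) with h | h
          · rw [smul_comm]
            exact P.smul_mem _ (ih _ (by push_cast at hj ⊢; omega))
          · rw [ha i h, zero_smul, smul_zero]
            exact P.zero_mem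
      · have h0 : r = 0 := by
          rw [DFinsupp.mem_support_iff, not_not] at ht
          simp only [r, ht]
          rfl
        rw [h0, pow_succ, mul_zero, zero_smul]
        exact P.zero_mem
  refine ⟨(u - l).toNat, mem_of_forall_decompose_mem (ℳ := ℳ) fun j => ?_⟩
  have hmem : r ^ (u - l).toNat ∈ 𝒜 ((u - l).toNat * t) := by
    have h := SetLike.pow_mem_graded (A := 𝒜) (u - l).toNat (DirectSum.decompose 𝒜 a t).2
    rwa [smul_eq_mul] at h
  rw [decompose_smul_of_mem hsmul hmem]
  by_cases h : j - ((u - l).toNat * t : ℕ) < l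
  · rw [hul _ (Or.inr h), smul_zero]
    exact P.zero_mem
  · exact key _ _ (by omega)

/-- Primes associated to a graded module are homogeneous. -/
theorem isHomogeneous_of_mem_relAss {P K : Submodule R M} (hP : P.IsHomogeneous ℳ) {𝔭 : Ideal R}
    (h : 𝔭 ∈ relAss P K) : 𝔭.IsHomogeneous 𝒜 := by
  classical
  obtain ⟨hp, x, -, hpx⟩ := h
  intro i a ha
  by_contra hi
  -- Otherwise take the highest component outside `𝔭`, and discard the higher ones.
  let S := (DirectSum.decompose 𝒜 a).support.filter
    fun k => (DirectSum.decompose 𝒜 a k : R) ∉ 𝔭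
  have hne : S.Nonempty := by
    refine ⟨i, Finset.mem_filter.2 ⟨?_, hi⟩⟩
    rw [DFinsupp.mem_support_iff]
    exact fun h0 => hi (by rw [h0]; exact 𝔭.zero_mem)
  obtain ⟨t, ht, hmax⟩ := S.exists_max_image id hne
  let a' := ∑ k ∈ (DirectSum.decompose 𝒜 a).support.filter (· ≤ t),
    (DirectSum.decompose 𝒜 a k : R)
  have ha' : a' ∈ 𝔭 := by
    have h1 := Finset.sum_filter_add_sum_filter_not (DirectSum.decompose 𝒜 a).support (· ≤ t)
      fun k => (DirectSum.decompose 𝒜 a k : R)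
    rw [DirectSum.sum_support_decompose] at h1
    rw [← h1] at ha
    refine (𝔭.add_mem_iff_left (𝔭.sum_mem fun k hk => ?_)).1 ha
    by_contra hk'
    rw [Finset.mem_filter] at hk
    exact hk.2 (hmax k (Finset.mem_filter.2 ⟨hk.1, hk'⟩))
  have hcomp : ∀ k, (DirectSum.decompose 𝒜 a' k : R) =
      if k ≤ t then (DirectSum.decompose 𝒜 a k : R) else 0 := by
    intro k
    rw [DirectSum.decompose_sum, DFinsupp.finsetSum_apply, AddSubmonoidClass.coe_finsetSum,
      Finset.sum_congr rfl fun m _ => decompose_coe_of_mem (DirectSum.decompose 𝒜 a m).2 k]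
    simp only [Finset.sum_ite_eq, Finset.mem_filter]
    by_cases hk : k ∈ (DirectSum.decompose 𝒜 a).support
    · simp [hk]
    · rw [DFinsupp.mem_support_iff, not_not] at hk
      simp [hk]
  obtain ⟨n, hn⟩ := exists_pow_smul_mem_of_smul_mem hsmul hP (a := a') (t := t)
    (fun k hk => by rw [hcomp, if_neg (by omega)]) (x := x)
    (Submodule.mem_colon_singleton.1 (hpx ▸ ha'))
  rw [hcomp, if_pos le_rfl, ← Submodule.mem_colon_singleton, ← hpx] at hn
  exact (Finset.mem_filter.1 ht).2 (hp.mem_of_pow_mem n hn)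

/-- The degrees of the homogeneous elements of `K` whose annihilator modulo `P` is `𝔭`. -/
def annDegrees (ℳ : ℤ → AddSubgroup M) (P K : Submodule R M) (𝔭 : Ideal R) : Set ℤ :=
  {j | ∃ x ∈ ℳ j, x ∈ K ∧ 𝔭 = P.colon {x}}

/-- A prime associated to a graded subquotient is the annihilator of a homogeneous element. -/
theorem annDegrees_nonempty {P K : Submodule R M} (hP : P.IsHomogeneous ℳ)
    (hK : K.IsHomogeneous ℳ) {𝔭 : Ideal R} (h : 𝔭 ∈ relAss P K) :
    (annDegrees ℳ P K 𝔭).Nonempty := by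
  have h𝔭 := isHomogeneous_of_mem_relAss hsmul hP h
  obtain ⟨hp, x, hx, hpx⟩ := h
  rw [eq_colon_singleton_iff] at hpx
  by_contra hcon
  refine hpx.2 (mem_of_forall_decompose_mem (ℳ := ℳ) fun j => ?_)
  by_contra hj
  exact hcon ⟨j, _, (DirectSum.decompose ℳ x j).2, hK j hx,
    eq_colon_singleton_iff.2 ⟨isHomogeneous_modColon hsmul h𝔭 hP j hpx.1, hj⟩⟩

/-- A finitely generated `ℤ`-graded module over an `ℕ`-graded ring is bounded below. -/
theorem exists_forall_lt_decompose_eq_zero [Module.Finite R M] :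
    ∃ m : ℤ, ∀ x : M, ∀ j < m, (DirectSum.decompose ℳ x j : M) = 0 := by
  obtain ⟨Q, hQ, hspan⟩ := exists_finset_homogeneous_span_eq (R := R) (ℳ := ℳ)
    (P := ⊤) (fun _ _ _ => trivial) Module.Finite.fg_top
  choose! e he using hQ
  obtain ⟨m, hm⟩ := (Q.image e).bddBelow
  refine ⟨m, fun x => ?_⟩
  have hx : x ∈ Submodule.span R (Q : Set M) := hspan ▸ Submodule.mem_top
  induction hx using Submodule.span_induction with
  | mem q hq =>
    intro j hj
    have h1 : m ≤ e q := hm (Finset.mem_coe.2 (Finset.mem_image_of_mem e hq))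
    rw [decompose_coe_of_mem (he q hq), if_neg (by omega)]
  | zero => simp
  | add x y _ _ hx hy =>
    intro j hj
    simp [hx j hj, hy j hj]
  | smul a x _ hx =>
    intro j hj
    rw [decompose_smul hsmul]
    exact Finset.sum_eq_zero fun i _ => by rw [hx _ (by omega), smul_zero]

/-- If the generators of `I` have positive degrees, then the least degree of `I ^ n N` grows at
least linearly in `n`. -/
theorem decompose_eq_zero_of_mem_pow_smul {I : Ideal R}
    (hI : ∀ a ∈ I, (DirectSum.decompose 𝒜 a 0 : R) = 0) {m : ℤ}
    (hm : ∀ x : M, ∀ j < m, (DirectSum.decompose ℳ x j : M) = 0) (N : Submodule R M) (n : ℕ) :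
    ∀ x ∈ I ^ n • N, ∀ j < m + n, (DirectSum.decompose ℳ x j : M) = 0 := by
  induction n with
  | zero => exact fun x _ j hj => hm x j (by simpa using hj)
  | succ n ih =>
    intro x hx j hj
    rw [pow_succ_smul_eq] at hx
    induction hx using Submodule.smul_induction_on' with
    | smul a ha x hx =>
      rw [decompose_smul hsmul]
      refine Finset.sum_eq_zero fun i _ => ?_
      rcases Nat.eq_zero_or_pos i with rfl | hi
      · rw [hI a ha, zero_smul]
      · rw [ih x hx _ (by push_cast at hj; omega), smul_zero]
    | add x _ y _ hx hy => simp [hx, hy]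

end Graded

/-! ### The least degree of elements with a given annihilator in `I ^ n N / I ^ (n + 1) N` -/

section Main

variable {R : Type*} [CommRing R] {M : Type*} [AddCommGroup M] [Module R M]

theorem pow_smul_span_le {c : ℕ} (y : Fin c → R) (Q : Set M) (t : ℕ) :
    Ideal.span (Set.range y) ^ t • Submodule.span R Q ≤ Submodule.span R
      {x | ∃ α : Fin c → ℕ, ∑ i, α i = t ∧ ∃ q ∈ Q, x = (∏ i, y i ^ α i) • q} := by
  induction t with
  | zero =>
    rw [pow_zero, Ideal.one_eq_top, Submodule.top_smul]
    exact Submodule.span_mono fun q hq => ⟨0, by simp, q, hq, by simp⟩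
  | succ t ih =>
    rw [pow_succ_smul_eq]
    refine (smul_mono_right _ ih).trans ?_
    rw [Ideal.span, Submodule.span_smul_span, Submodule.span_le]
    intro x hx
    obtain ⟨_, ⟨i, rfl⟩, _, ⟨α, rfl, q, hq, rfl⟩, rfl⟩ := Set.mem_smul.1 hx
    have h1 : ∑ j, (α + Pi.single i 1 : Fin c → ℕ) j = ∑ j, α j + 1 := by
      simp [Finset.sum_add_distrib]
    have h2 : ∏ j, y j ^ (α + Pi.single i 1 : Fin c → ℕ) j = y i * ∏ j, y j ^ α j := by
      simp only [Pi.add_apply, pow_add, Finset.prod_mul_distrib]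
      rw [mul_comm, Finset.prod_eq_single_of_mem i (Finset.mem_univ i)]
      · simp
      · intro j _ hj
        simp [hj]
    refine Submodule.subset_span ⟨α + Pi.single i 1, h1, q, hq, ?_⟩
    rw [h2, mul_smul]

theorem prod_pow_mem_pow {c : ℕ} (y : Fin c → R) (α : Fin c → ℕ) :
    ∏ i, y i ^ α i ∈ Ideal.span (Set.range y) ^ (∑ i, α i) := by
  rw [← Finset.prod_pow_eq_pow_sum]
  exact Ideal.prod_mem_prod fun i _ =>
    Ideal.pow_mem_pow (Ideal.subset_span (Set.mem_range_self i)) _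

variable [IsNoetherianRing R] [Module.Finite R M]
  {ℳ : ℤ → AddSubgroup M} [DirectSum.Decomposition ℳ] {𝒜 : ℕ → AddSubgroup R} [GradedRing 𝒜]

/-- The least degree of a homogeneous element of `I ^ (n - 1) N / I ^ n N` with annihilator `𝔭` is
eventually affine in `n`. Indeed, by Artin-Rees, the elements killed by `𝔭` are, for large `n`,
spanned by the products of monomials in the generators of `I` with finitely many homogeneous
elements `q`; and the exponents of the monomials whose product with `q` survives at `𝔭` form a
lower set. -/
theorem eventuallyAffineMin_annDegrees
    (hsmul : ∀ (i : ℕ) (j : ℤ) (r : R) (x : M), r ∈ 𝒜 i → x ∈ ℳ j → r • x ∈ ℳ ((i : ℤ) + j))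
    {N : Submodule R M} (hN : N.IsHomogeneous ℳ) {c : ℕ} {y : Fin c → R} {d : Fin c → ℕ}
    (hy : ∀ i, y i ∈ 𝒜 (d i)) {I : Ideal R} (hI : I = Ideal.span (Set.range y))
    {𝔭 : Ideal R} [h𝔭 : 𝔭.IsPrime] (h𝔭hom : 𝔭.IsHomogeneous 𝒜) :
    EventuallyAffineMin (Set.range d)
      fun n => annDegrees ℳ (I ^ n • N) (I ^ (n - 1) • N) 𝔭 := by
  have hIhom : I.IsHomogeneous 𝒜 := by
    rw [hI]
    refine Ideal.homogeneous_span _ _ ?_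
    rintro _ ⟨i, rfl⟩
    exact ⟨d i, hy i⟩
  have hpow := isHomogeneous_pow_smul hsmul hIhom hN
  obtain ⟨n₀, hn₀⟩ := (annFiltration_stable I 𝔭 N).exists_pow_smul_eq
  have hLhom : ((annFiltration I 𝔭 N).N n₀).IsHomogeneous ℳ :=
    isHomogeneous_inf (hpow n₀) (isHomogeneous_modColon hsmul h𝔭hom (hpow (n₀ + 1)))
  obtain ⟨Q, hQ, hspan⟩ := exists_finset_homogeneous_span_eq hLhom (IsNoetherian.noetherian _)
  choose! e he using hQ
  let P : ℕ → Submodule R M := fun t => I ^ (n₀ + t + 1) • N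
  let E : M → Set (Fin c → ℕ) := fun q =>
    {α | (∏ i, y i ^ α i) • q ∉ saturation (P (∑ i, α i)) 𝔭}
  have hE : ∀ q, IsLowerSet (E q) := by
    intro q α β hβα hα hβ
    refine hα ?_
    obtain ⟨γ, rfl⟩ := exists_add_of_le hβα
    obtain ⟨s, hs, hsβ⟩ := hβ
    refine ⟨s, hs, ?_⟩
    have h1 : P (∑ i, (β + γ) i) = I ^ (∑ i, γ i) • P (∑ i, β i) := by
      simp only [P, Pi.add_apply, Finset.sum_add_distrib, smul_smul, ← pow_add]
      congr 2
      omega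
    have h2 : s • (∏ i, y i ^ (β + γ) i) • q
        = (∏ i, y i ^ γ i) • s • (∏ i, y i ^ β i) • q := by
      simp only [Pi.add_apply, pow_add, Finset.prod_mul_distrib, smul_smul]
      congr 1
      ring
    rw [h1, h2]
    exact Submodule.smul_mem_smul (hI ▸ prod_pow_mem_pow y γ) hsβ
  have hdeg : ∀ q ∈ Q, ∀ α : Fin c → ℕ,
      (∏ i, y i ^ α i) • q ∈ ℳ (∑ i, (d i : ℤ) * α i + e q) := by
    intro q hq α
    have h1 : ∏ i, y i ^ α i ∈ 𝒜 (∑ i, α i * d i) := by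
      refine SetLike.prod_mem_graded 𝒜 _ _ fun i _ => ?_
      exact SetLike.pow_mem_graded (α i) (hy i)
    have h2 := hsmul _ _ _ _ h1 (he q hq)
    have h3 : ((∑ i, α i * d i : ℕ) : ℤ) = ∑ i, (d i : ℤ) * α i := by
      push_cast
      exact Finset.sum_congr rfl fun i _ => mul_comm _ _
    rwa [h3] at h2
  refine EventuallyAffineMin.of_add (n₀ + 1) ?_
  refine (EventuallyAffineMin.biUnion Q.finite_toSet
    fun q _ => eventuallyAffineMin_weights d (e q) (E q) (hE q)).of_subset ?_ ?_
  · intro t z hz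
    simp only [Set.mem_iUnion] at hz
    obtain ⟨q, hq, α, hα, rfl, rfl⟩ := hz
    have h1 : (∏ i, y i ^ α i) • q ∈ (annFiltration I 𝔭 N).N (n₀ + ∑ i, α i) := by
      rw [hn₀]
      exact Submodule.smul_mem_smul (hI ▸ prod_pow_mem_pow y α)
        (hspan ▸ Submodule.subset_span hq)
    have h2 : ∑ i, α i + (n₀ + 1) = n₀ + ∑ i, α i + 1 := by omega
    rw [h2]
    exact ⟨_, hdeg q hq α, h1.1, eq_colon_singleton_iff.2 ⟨h1.2, hα⟩⟩
  · rintro t z hz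
    have h2 : t + (n₀ + 1) = n₀ + t + 1 := by omega
    rw [h2] at hz
    obtain ⟨x, hxz, hx, hpx⟩ := hz
    rw [eq_colon_singleton_iff] at hpx
    by_contra! hcon
    have hxL : x ∈ I ^ t • (annFiltration I 𝔭 N).N n₀ := by
      rw [← hn₀]
      exact ⟨hx, hpx.1⟩
    rw [← hspan, hI] at hxL
    -- No spanning element of degree at most `z` survives at `𝔭`; hence no such component does.
    have key : ∀ k ≤ z, (DirectSum.decompose ℳ x k : M) ∈ saturation (P t) 𝔭 := by
      have h3 := pow_smul_span_le y (Q : Set M) t hxL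
      clear hxL hpx hx hxz
      induction h3 using Submodule.span_induction with
      | mem x hx =>
        obtain ⟨α, rfl, q, hq, rfl⟩ := hx
        intro k hk
        rw [decompose_coe_of_mem (hdeg q hq α)]
        split_ifs with h
        · by_contra hs
          have h4 := hcon (∑ i, (d i : ℤ) * α i + e q)
            (Set.mem_biUnion hq ⟨α, hs, rfl, rfl⟩)
          omega
        · exact Submodule.zero_mem _
      | zero => simp
      | add x y _ _ hx hy =>
        intro k hk
        rw [DirectSum.decompose_add, DirectSum.add_apply, AddSubgroup.coe_add]
        exact Submodule.add_mem _ (hx k hk) (hy k hk)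
      | smul a x _ hx =>
        intro k hk
        classical
        rw [decompose_smul hsmul]
        exact Submodule.sum_mem _ fun i _ => Submodule.smul_mem _ _ (hx _ (by omega))
    have h3 := key z le_rfl
    rw [decompose_coe_of_mem hxz, if_pos rfl] at h3
    exact hpx.2 h3

end Main

/-! ### v-numbers of graded subquotients -/

section SubquotientGrading

variable {R : Type*} [CommRing R] {M : Type*} [AddCommGroup M] [Module R M]

/-- The infimum in the extended reals of a set of integers. -/
noncomputable def infDeg (S : Set ℤ) : EReal := ⨅ j ∈ S, ((j : ℝ) : EReal)

theorem infDeg_anti {S T : Set ℤ} (h : S ⊆ T) : infDeg T ≤ infDeg S :=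
  biInf_mono h

theorem infDeg_eq_of_isLeast {S : Set ℤ} {z : ℤ} (h : IsLeast S z) :
    infDeg S = ((z : ℝ) : EReal) :=
  le_antisymm (iInf₂_le z h.1) (le_iInf₂ fun j hj => by exact_mod_cast h.2 hj)

theorem infDeg_union_eq_right {S T : Set ℤ} {z : ℤ} (hz : z ∈ T) (h : ∀ j ∈ S, z ≤ j) :
    infDeg (S ∪ T) = infDeg T := by
  refine le_antisymm (infDeg_anti Set.subset_union_right) (le_iInf₂ fun j hj => ?_)
  rcases hj with hj | hj
  · exact (iInf₂_le z hz).trans (by exact_mod_cast h j hj)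
  · exact iInf₂_le j hj

/-- The degrees of the homogeneous elements of `K` whose annihilator modulo `P` is prime. -/
def primeDegrees (ℳ : ℤ → AddSubgroup M) (P K : Submodule R M) : Set ℤ :=
  {j | ∃ 𝔭 : Ideal R, 𝔭.IsPrime ∧ j ∈ annDegrees ℳ P K 𝔭}

theorem mem_relAss_of_mem_annDegrees {ℳ : ℤ → AddSubgroup M} {P K : Submodule R M} {𝔭 : Ideal R}
    (hp : 𝔭.IsPrime) {j : ℤ} (hj : j ∈ annDegrees ℳ P K 𝔭) : 𝔭 ∈ relAss P K := by
  obtain ⟨x, -, hx, hpx⟩ := hj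
  exact ⟨hp, x, hx, hpx⟩

/-- The graded module `(Q, 𝒢)` is isomorphic to the subquotient `K / (K ∩ P)` of `(M, ℳ)`, with
the induced grading. -/
def IsGradedSubquotient (ℳ : ℤ → AddSubgroup M) (P K : Submodule R M) {Q : Type*} [AddCommGroup Q]
    [Module R Q] (𝒢 : ℤ → AddSubgroup Q) : Prop :=
  ∃ f : K →ₗ[R] Q, Function.Surjective f ∧ (∀ x, f x = 0 ↔ (x : M) ∈ P) ∧
    ∀ j q, q ∈ 𝒢 j ↔ ∃ x : K, (x : M) ∈ ℳ j ∧ f x = q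

variable {ℳ : ℤ → AddSubgroup M} {P K : Submodule R M} {Q : Type*} [AddCommGroup Q] [Module R Q]
  {𝒢 : ℤ → AddSubgroup Q}

theorem IsGradedSubquotient.localV_eq (h : IsGradedSubquotient ℳ P K 𝒢) (𝔭 : Ideal R) :
    localV 𝒢 𝔭 = infDeg (annDegrees ℳ P K 𝔭) := by
  obtain ⟨f, -, hker, h𝒢⟩ := h
  have key : ∀ x : K, (⊥ : Submodule R Q).colon {f x} = P.colon {(x : M)} := fun x => by
    ext a
    rw [Submodule.mem_colon_singleton, Submodule.mem_colon_singleton, Submodule.mem_bot,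
      ← map_smul, hker]
    rfl
  unfold localV infDeg
  refine iInf_congr fun j => iInf_congr_Prop ?_ fun _ => rfl
  constructor
  · rintro ⟨q, hq, hpq⟩
    obtain ⟨x, hx, rfl⟩ := (h𝒢 j q).1 hq
    exact ⟨x, hx, x.2, hpq.trans (key x)⟩
  · rintro ⟨x, hxj, hxK, hpx⟩
    exact ⟨f ⟨x, hxK⟩, (h𝒢 j _).2 ⟨⟨x, hxK⟩, hxj, rfl⟩, hpx.trans (key ⟨x, hxK⟩).symm⟩

theorem IsGradedSubquotient.globalV_eq [IsNoetherianRing R] (h : IsGradedSubquotient ℳ P K 𝒢) :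
    globalV R 𝒢 = infDeg (primeDegrees ℳ P K) := by
  unfold globalV
  simp only [h.localV_eq]
  obtain ⟨f, hf, hker, -⟩ := h
  refine le_antisymm (le_iInf₂ fun j hj => ?_) (le_iInf₂ fun 𝔭 hp => ?_)
  · obtain ⟨𝔭, hp, hj⟩ := hj
    exact (iInf₂_le 𝔭 ((mem_associatedPrimes_iff_mem_relAss f hf hker).2
      (mem_relAss_of_mem_annDegrees hp hj))).trans (iInf₂_le j hj)
  · exact infDeg_anti fun j hj => ⟨𝔭, hp.isPrime, hj⟩

theorem isGradedSubquotient_quotPow (I : Ideal R) (N : Submodule R M) (n : ℕ) :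
    IsGradedSubquotient ℳ (I ^ n • N) ⊤ (quotPowGrading ℳ I N n) := by
  refine ⟨(I ^ n • N).mkQ ∘ₗ (⊤ : Submodule R M).subtype, fun x => ?_, fun x => by simp, ?_⟩
  · obtain ⟨m, rfl⟩ := (I ^ n • N).mkQ_surjective x
    exact ⟨⟨m, trivial⟩, rfl⟩
  · rintro j q
    constructor
    · rintro ⟨x, hx, rfl⟩
      exact ⟨⟨x, trivial⟩, hx, rfl⟩
    · rintro ⟨x, hx, rfl⟩
      exact ⟨x, hx, rfl⟩

theorem isGradedSubquotient_grPow (I : Ideal R) (N : Submodule R M) (n : ℕ) :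
    IsGradedSubquotient ℳ (I ^ n • N) (I ^ (n - 1) • N) (grPowGrading ℳ I N n) := by
  refine ⟨((I ^ n • N).submoduleOf (I ^ (n - 1) • N)).mkQ, Submodule.mkQ_surjective _,
    fun x => ?_, fun j q => Iff.rfl⟩
  rw [Submodule.mkQ_apply, Submodule.Quotient.mk_eq_zero]
  rfl

theorem isGradedSubquotient_subGrading (K : Submodule R M) :
    IsGradedSubquotient ℳ ⊥ K (subGrading ℳ K) := by
  refine ⟨LinearMap.id, Function.surjective_id, fun x => by simp, fun j q => ?_⟩
  constructor
  · intro h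
    exact ⟨q, h, rfl⟩
  · rintro ⟨x, hx, rfl⟩
    exact hx

theorem isGradedSubquotient_self : IsGradedSubquotient ℳ (⊥ : Submodule R M) ⊤ ℳ := by
  refine ⟨(⊤ : Submodule R M).subtype, fun x => ⟨⟨x, trivial⟩, rfl⟩, fun x => by simp,
    fun j q => ?_⟩
  constructor
  · intro h
    exact ⟨⟨q, trivial⟩, h, rfl⟩
  · rintro ⟨x, hx, rfl⟩
    exact hx

end SubquotientGrading

/-! ### The splitting of `(I ^ n N :_M I) / I ^ n N` -/

section Splitting

variable {R : Type*} [CommRing R] [IsNoetherianRing R] {M : Type*} [AddCommGroup M] [Module R M]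
  [Module.Finite R M] {ℳ : ℤ → AddSubgroup M}

/-- For large `n`, the module `(0 :_M I)` meets `I ^ n N` trivially, hence embeds into
`M / I ^ n N`. -/
theorem eventually_annDegrees_colonZero_subset (ℳ : ℤ → AddSubgroup M) (I : Ideal R)
    (N : Submodule R M) : ∀ᶠ n in atTop, ∀ 𝔭 : Ideal R,
      annDegrees ℳ ⊥ (colonZero M I) 𝔭 ⊆ annDegrees ℳ (I ^ n • N) ⊤ 𝔭 := by
  filter_upwards [eventually_pow_smul_inf_colonZero_eq_bot I N] with n hn 𝔭
  rintro j ⟨x, hxj, hx, rfl⟩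
  refine ⟨x, hxj, trivial, ?_⟩
  ext a
  rw [Submodule.mem_colon_singleton, Submodule.mem_colon_singleton]
  refine ⟨fun h => ?_, fun h => ?_⟩
  · rw [(Submodule.mem_bot R).1 h]
    exact Submodule.zero_mem _
  · rw [← hn]
    exact ⟨h, Submodule.smul_mem _ a hx⟩

/-- For large `n`, the module `(I ^ n N :_M I) / I ^ n N` is the direct sum of
`I ^ (n - 1) N / I ^ n N` and `(0 :_M I)`; an element whose annihilator is a prime `𝔭 ⊇ I` thus has
a component with the same annihilator in one of the summands. -/
theorem eventually_annDegrees_quotPow_eq [DirectSum.Decomposition ℳ] {𝒜 : ℕ → AddSubgroup R}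
    [GradedRing 𝒜]
    (hsmul : ∀ (i : ℕ) (j : ℤ) (r : R) (x : M), r ∈ 𝒜 i → x ∈ ℳ j → r • x ∈ ℳ ((i : ℤ) + j))
    {N : Submodule R M} (hN : N.IsHomogeneous ℳ) {I : Ideal R} (hI : I.IsHomogeneous 𝒜) :
    ∀ᶠ n in atTop, ∀ 𝔭 : Ideal R, 𝔭.IsPrime → I ≤ 𝔭 →
      annDegrees ℳ (I ^ n • N) ⊤ 𝔭 =
        annDegrees ℳ (I ^ n • N) (I ^ (n - 1) • N) 𝔭 ∪ annDegrees ℳ ⊥ (colonZero M I) 𝔭 := by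
  have h1 := (tendsto_sub_atTop_nat 1).eventually (eventually_modColon_pow_le I N)
  have h2 := (tendsto_sub_atTop_nat 1).eventually (eventually_pow_smul_inf_colonZero_eq_bot I N)
  filter_upwards [h1, h2, eventually_annDegrees_colonZero_subset ℳ I N, eventually_ge_atTop 1]
    with n h1 h2 h3 hn 𝔭 hp hIp
  rw [Nat.sub_add_cancel hn] at h1
  refine Set.Subset.antisymm ?_ (Set.union_subset ?_ (h3 𝔭))
  · rintro j ⟨x, hxj, -, hpx⟩
    rw [eq_colon_singleton_iff] at hpx
    obtain ⟨u, hu, z, hz, huz⟩ := Submodule.mem_sup.1 (h1 fun a ha => hpx.1 a (hIp ha))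
    have hx : x = DirectSum.decompose ℳ u j + DirectSum.decompose ℳ z j := by
      rw [← AddSubgroup.coe_add, ← DirectSum.add_apply, ← DirectSum.decompose_add, huz,
        DirectSum.decompose_of_mem_same ℳ hxj]
    have hu' := isHomogeneous_pow_smul hsmul hI hN (n - 1) j hu
    have hz' := isHomogeneous_colonZero (ℳ := ℳ) hsmul hI j hz
    have huj := (DirectSum.decompose ℳ u j).2
    have hzj := (DirectSum.decompose ℳ z j).2
    generalize (DirectSum.decompose ℳ u j : M) = u' at hx hu' huj
    generalize (DirectSum.decompose ℳ z j : M) = z' at hx hz' hzj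
    subst hx
    have hle : I ^ n • N ≤ I ^ (n - 1) • N := by
      obtain ⟨k, rfl⟩ := Nat.exists_eq_add_of_le' hn
      exact pow_succ_smul_le I N k
    have hpz : ∀ a ∈ 𝔭, a • z' = 0 := by
      intro a ha
      have h4 := hle (hpx.1 a ha)
      rw [smul_add] at h4
      have h5 := ((I ^ (n - 1) • N).add_mem_iff_right (Submodule.smul_mem _ a hu')).1 h4
      have h6 : a • z' ∈ I ^ (n - 1) • N ⊓ colonZero M I := ⟨h5, Submodule.smul_mem _ a hz'⟩
      rwa [h2, Submodule.mem_bot] at h6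
    by_cases hs : u' ∈ saturation (I ^ n • N) 𝔭
    · refine Or.inr ⟨z', hzj, hz', eq_colon_singleton_iff.2
        ⟨fun a ha => (Submodule.mem_bot R).2 (hpz a ha), ?_⟩⟩
      rintro ⟨s, hs', hsz⟩
      refine hpx.2 (Submodule.add_mem _ hs ⟨s, hs', ?_⟩)
      rw [(Submodule.mem_bot R).1 hsz]
      exact Submodule.zero_mem _
    · refine Or.inl ⟨u', huj, hu', eq_colon_singleton_iff.2 ⟨fun a ha => ?_, hs⟩⟩
      have h4 := hpx.1 a ha
      rwa [smul_add, hpz a ha, add_zero] at h4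
  · rintro j ⟨x, hxj, -, hpx⟩
    exact ⟨x, hxj, trivial, hpx⟩

end Splitting

end VNumber

/-! ### Asymptotics of the local and global v-numbers -/

theorem theorem3p9
    {R : Type*} [CommRing R] [IsNoetherianRing R]
    (𝒜 : ℕ → AddSubgroup R) [GradedRing 𝒜]
    {M : Type*} [AddCommGroup M] [Module R M] [Module.Finite R M]
    (ℳ : ℤ → AddSubgroup M) [DirectSum.Decomposition ℳ]
    (hsmul : ∀ (i : ℕ) (j : ℤ) (r : R) (x : M), r ∈ 𝒜 i → x ∈ ℳ j → r • x ∈ ℳ ((i : ℤ) + j))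
    (N : Submodule R M) (hN : N.IsHomogeneous ℳ)
    (c : ℕ) (y : Fin c → R) (d : Fin c → ℕ) (hy : ∀ i, y i ∈ 𝒜 (d i))
    (I : Ideal R) (hI : I = Ideal.span (Set.range y)) :
    -- part (1)
    (∀ 𝔭 ∈ VNumber.stableA I N,
      𝔭 ∉ associatedPrimes R (VNumber.colonZero M I) → I ≤ 𝔭 →
        𝔭 ∈ VNumber.stableB I N ∧
        ∃ a ∈ Set.range d, ∃ b : ℤ, ∀ᶠ n : ℕ in atTop,
          VNumber.localV (VNumber.quotPowGrading ℳ I N n) 𝔭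
              = VNumber.localV (VNumber.grPowGrading ℳ I N n) 𝔭 ∧
          VNumber.localV (VNumber.grPowGrading ℳ I N n) 𝔭
              = (((a : ℝ) * (n : ℝ) + (b : ℝ) : ℝ) : EReal)) ∧
    -- part (2)
    (∀ 𝔭 ∈ VNumber.stableA I N,
      𝔭 ∈ associatedPrimes R (VNumber.colonZero M I) → (∀ i, 1 ≤ d i) →
        ∀ᶠ n : ℕ in atTop,
          VNumber.localV (VNumber.quotPowGrading ℳ I N n) 𝔭 = VNumber.localV ℳ 𝔭 ∧
          VNumber.localV ℳ 𝔭
              = VNumber.localV (VNumber.subGrading ℳ (VNumber.colonZero M I)) 𝔭) ∧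
    -- part (3)
    (VNumber.colonZero M I ≠ ⊥ →
      (∀ᶠ n : ℕ in atTop,
        VNumber.globalV R (VNumber.quotPowGrading ℳ I N n)
            ≤ VNumber.globalV R (VNumber.subGrading ℳ (VNumber.colonZero M I))) ∧
      ((∀ i, 1 ≤ d i) → (∀ 𝔭 ∈ VNumber.stableA I N, I ≤ 𝔭) →
        ∀ᶠ n : ℕ in atTop,
          VNumber.globalV R (VNumber.quotPowGrading ℳ I N n)
              = VNumber.globalV R (VNumber.subGrading ℳ (VNumber.colonZero M I)))) ∧
    -- part (4)
    (VNumber.colonZero M I = ⊥ → (VNumber.stableA I N).Nonempty →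
      (∀ 𝔭 ∈ VNumber.stableA I N, I ≤ 𝔭) →
        ∃ a ∈ Set.range d, ∃ b : ℤ, ∀ᶠ n : ℕ in atTop,
          VNumber.globalV R (VNumber.quotPowGrading ℳ I N n)
              = VNumber.globalV R (VNumber.grPowGrading ℳ I N n) ∧
          VNumber.globalV R (VNumber.grPowGrading ℳ I N n)
              = (((a : ℝ) * (n : ℝ) + (b : ℝ) : ℝ) : EReal)) := by
  have hIhom : I.IsHomogeneous 𝒜 := by
    rw [hI]
    refine Ideal.homogeneous_span _ _ ?_
    rintro _ ⟨i, rfl⟩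
    exact ⟨d i, hy i⟩
  have hpow := VNumber.isHomogeneous_pow_smul hsmul hIhom hN
  have hzero := VNumber.isHomogeneous_colonZero (ℳ := ℳ) hsmul hIhom
  have hsplit := VNumber.eventually_annDegrees_quotPow_eq hsmul hN hIhom
  have hA := VNumber.eventually_associatedPrimes_quotPow_subset I N
  simp only [fun n => (VNumber.isGradedSubquotient_quotPow (ℳ := ℳ) I N n).localV_eq,
    fun n => (VNumber.isGradedSubquotient_grPow (ℳ := ℳ) I N n).localV_eq,
    fun n => (VNumber.isGradedSubquotient_quotPow (ℳ := ℳ) I N n).globalV_eq,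
    fun n => (VNumber.isGradedSubquotient_grPow (ℳ := ℳ) I N n).globalV_eq,
    (VNumber.isGradedSubquotient_self (R := R) (ℳ := ℳ)).localV_eq,
    (VNumber.isGradedSubquotient_subGrading (ℳ := ℳ) (VNumber.colonZero M I)).localV_eq,
    (VNumber.isGradedSubquotient_subGrading (ℳ := ℳ) (VNumber.colonZero M I)).globalV_eq,
    VNumber.mem_associatedPrimes_submodule_iff]
  have hempty : ∀ 𝔭 : Ideal R, 𝔭.IsPrime → 𝔭 ∉ VNumber.relAss ⊥ (VNumber.colonZero M I) →
      VNumber.annDegrees ℳ ⊥ (VNumber.colonZero M I) 𝔭 = ∅ := fun 𝔭 hp h =>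
    Set.eq_empty_iff_forall_notMem.2 fun j hj => h (VNumber.mem_relAss_of_mem_annDegrees hp hj)
  have hprime : ∀ 𝔭 ∈ VNumber.stableA I N, 𝔭.IsPrime := fun 𝔭 hp => by
    obtain ⟨n, hn⟩ := hp.exists
    exact hn.isPrime
  -- Stable primes of `M / I ^ n N` that contain `I` and are not associated to `(0 :_M I)`.
  have hlocal : ∀ 𝔭 ∈ VNumber.stableA I N, 𝔭 ∉ VNumber.relAss ⊥ (VNumber.colonZero M I) → I ≤ 𝔭 →
      𝔭 ∈ VNumber.stableB I N ∧ (∀ᶠ n in atTop,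
        (VNumber.annDegrees ℳ (I ^ n • N) (I ^ (n - 1) • N) 𝔭).Nonempty) ∧
      VNumber.EventuallyAffineMin (Set.range d)
        (fun n => VNumber.annDegrees ℳ (I ^ n • N) (I ^ (n - 1) • N) 𝔭) := by
    intro 𝔭 hpA hpZ hIp
    have hp := hprime 𝔭 hpA
    have hne : ∀ᶠ n in atTop,
        (VNumber.annDegrees ℳ (I ^ n • N) (I ^ (n - 1) • N) 𝔭).Nonempty := by
      filter_upwards [hsplit, hpA] with n h1 h2
      have h3 := VNumber.annDegrees_nonempty (K := ⊤) hsmul (hpow n) (fun _ _ _ => trivial)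
        (VNumber.mem_associatedPrimes_quotPow_iff.1 h2)
      rwa [h1 𝔭 hp hIp, hempty 𝔭 hp hpZ, Set.union_empty] at h3
    refine ⟨?_, hne, ?_⟩
    · filter_upwards [hne] with n ⟨j, hj⟩
      exact VNumber.mem_associatedPrimes_grPow_iff.2
        (VNumber.mem_relAss_of_mem_annDegrees hp hj)
    · obtain ⟨n, hn⟩ := hpA.exists
      have h𝔭hom := VNumber.isHomogeneous_of_mem_relAss hsmul (hpow n)
        (VNumber.mem_associatedPrimes_quotPow_iff.1 hn)
      exact VNumber.eventuallyAffineMin_annDegrees hsmul hN hy hI h𝔭hom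
  -- If the degrees `d i` are positive, then `I ^ (n - 1) N` lives in large degrees.
  have hlarge : (∀ i, 1 ≤ d i) → ∀ z : ℤ, ∀ᶠ n in atTop, ∀ 𝔭 : Ideal R, 𝔭.IsPrime →
      ∀ j ∈ VNumber.annDegrees ℳ (I ^ n • N) (I ^ (n - 1) • N) 𝔭, z ≤ j := by
    intro hd z
    obtain ⟨m, hm⟩ := VNumber.exists_forall_lt_decompose_eq_zero (R := R) (ℳ := ℳ) hsmul
    have hI0 : ∀ a ∈ I, (DirectSum.decompose 𝒜 a 0 : R) = 0 := by
      have h1 : I ≤ RingHom.ker (GradedRing.projZeroRingHom 𝒜) := by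
        rw [hI, Ideal.span_le]
        rintro _ ⟨i, rfl⟩
        have := hd i
        rw [SetLike.mem_coe, RingHom.mem_ker, GradedRing.projZeroRingHom_apply,
          VNumber.decompose_coe_of_mem (hy i), if_neg (by omega)]
      exact fun a ha => h1 ha
    filter_upwards [eventually_ge_atTop ((z - m).toNat + 1)] with n hn 𝔭 hp j hj
    obtain ⟨x, hxj, hx, hpx⟩ := hj
    by_contra hlt
    have h1 := VNumber.decompose_eq_zero_of_mem_pow_smul hsmul hI0 hm N (n - 1) x hx j (by omega)
    rw [VNumber.decompose_coe_of_mem hxj, if_pos rfl] at h1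
    rw [h1, Submodule.colon_singleton_zero] at hpx
    exact hp.ne_top hpx
  -- The splitting for all primes at once, when the stable primes of `M / I ^ n N` contain `I`.
  have hprimeSplit : (∀ 𝔭 ∈ VNumber.stableA I N, I ≤ 𝔭) → ∀ᶠ n in atTop,
      VNumber.primeDegrees ℳ (I ^ n • N) ⊤ =
        VNumber.primeDegrees ℳ (I ^ n • N) (I ^ (n - 1) • N) ∪
          VNumber.primeDegrees ℳ ⊥ (VNumber.colonZero M I) := by
    intro hV
    filter_upwards [hsplit, hA, VNumber.eventually_annDegrees_colonZero_subset ℳ I N]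
      with n h1 h2 h3
    refine Set.Subset.antisymm ?_ (Set.union_subset ?_ ?_)
    · rintro j ⟨𝔭, hp, hj⟩
      have h4 : I ≤ 𝔭 := hV 𝔭 (h2 (VNumber.mem_associatedPrimes_quotPow_iff.2
        (VNumber.mem_relAss_of_mem_annDegrees hp hj)))
      rw [h1 𝔭 hp h4] at hj
      exact hj.imp (fun h => ⟨𝔭, hp, h⟩) fun h => ⟨𝔭, hp, h⟩
    · rintro j ⟨𝔭, hp, x, hxj, -, hpx⟩
      exact ⟨𝔭, hp, x, hxj, trivial, hpx⟩
    · rintro j ⟨𝔭, hp, hj⟩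
      exact ⟨𝔭, hp, h3 𝔭 hj⟩
  refine ⟨fun 𝔭 hpA hpZ hIp => ?_, fun 𝔭 hpA hpZ hd => ?_, fun hne => ⟨?_, fun hd hV => ?_⟩,
    fun h0 hne hV => ?_⟩
  · have hp := hprime 𝔭 hpA
    obtain ⟨hB, hnonempty, haff⟩ := hlocal 𝔭 hpA hpZ hIp
    refine ⟨hB, ?_⟩
    obtain ⟨a, ha, b, hab⟩ := haff.resolve_of_nonempty hnonempty
    refine ⟨a, ha, b, ?_⟩
    filter_upwards [hsplit, hab] with n h1 h2
    rw [h1 𝔭 hp hIp, hempty 𝔭 hp hpZ, Set.union_empty]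
    refine ⟨rfl, ?_⟩
    rw [VNumber.infDeg_eq_of_isLeast h2]
    push_cast
    rfl
  · have hp := hprime 𝔭 hpA
    have hIp : I ≤ 𝔭 := by
      obtain ⟨-, z, hz, rfl⟩ := hpZ
      exact fun a ha => Submodule.mem_colon_singleton.2
        ((Submodule.mem_bot R).2 (VNumber.mem_colonZero.1 hz a ha))
    obtain ⟨z, hz⟩ := VNumber.annDegrees_nonempty (ℳ := ℳ) hsmul VNumber.isHomogeneous_bot hzero hpZ
    have hself : VNumber.annDegrees ℳ ⊥ ⊤ 𝔭 =
        VNumber.annDegrees ℳ ⊥ (VNumber.colonZero M I) 𝔭 := by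
      ext j
      constructor
      · rintro ⟨x, hxj, -, hpx⟩
        refine ⟨x, hxj, VNumber.mem_colonZero.2 fun a ha => ?_, hpx⟩
        have h1 := hIp ha
        rwa [hpx, Submodule.mem_colon_singleton, Submodule.mem_bot] at h1
      · rintro ⟨x, hxj, -, hpx⟩
        exact ⟨x, hxj, trivial, hpx⟩
    filter_upwards [hsplit, hlarge hd z] with n h1 h2
    rw [hself, h1 𝔭 hp hIp]
    exact ⟨VNumber.infDeg_union_eq_right hz (h2 𝔭 hp), rfl⟩
  · filter_upwards [VNumber.eventually_annDegrees_colonZero_subset ℳ I N] with n h1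
    refine VNumber.infDeg_anti ?_
    rintro j ⟨𝔭, hp, hj⟩
    exact ⟨𝔭, hp, h1 𝔭 hj⟩
  · have : Nontrivial (VNumber.colonZero M I) := Submodule.nontrivial_iff_ne_bot.2 hne
    obtain ⟨𝔭, hp⟩ := associatedPrimes.nonempty R (VNumber.colonZero M I)
    obtain ⟨z, hz⟩ := VNumber.annDegrees_nonempty (ℳ := ℳ) hsmul VNumber.isHomogeneous_bot hzero
      (VNumber.mem_associatedPrimes_submodule_iff.1 hp)
    filter_upwards [hprimeSplit hV, hlarge hd z] with n h1 h2
    rw [h1]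
    refine VNumber.infDeg_union_eq_right ⟨𝔭, hp.isPrime, hz⟩ ?_
    rintro j ⟨𝔮, hq, hj⟩
    exact h2 𝔮 hq j hj
  · have hZ : ∀ 𝔭, 𝔭 ∉ VNumber.relAss ⊥ (VNumber.colonZero M I) := by
      rintro 𝔭 ⟨hp, z, hz, hpz⟩
      rw [h0, Submodule.mem_bot] at hz
      rw [hz, Submodule.colon_singleton_zero] at hpz
      exact hp.ne_top hpz
    have hfin : (VNumber.stableA I N).Finite := by
      refine (VNumber.finite_iUnion_relAss_pow I N).subset fun 𝔭 hp => ?_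
      obtain ⟨n, hn, hn1⟩ :=
        ((hlocal 𝔭 hp (hZ 𝔭) (hV 𝔭 hp)).1.and (eventually_ge_atTop 1)).exists
      obtain ⟨k, rfl⟩ := Nat.exists_eq_add_of_le' hn1
      exact Set.mem_iUnion.2 ⟨k, VNumber.mem_associatedPrimes_grPow_iff.1 hn⟩
    have hunion : ∀ᶠ n in atTop,
        ⋃ 𝔭 ∈ VNumber.stableA I N, VNumber.annDegrees ℳ (I ^ n • N) (I ^ (n - 1) • N) 𝔭 =
          VNumber.primeDegrees ℳ (I ^ n • N) (I ^ (n - 1) • N) := by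
      filter_upwards [hA] with n h1
      ext j
      simp only [Set.mem_iUnion, exists_prop]
      constructor
      · rintro ⟨𝔭, hp, hj⟩
        exact ⟨𝔭, hprime 𝔭 hp, hj⟩
      · rintro ⟨𝔭, hp, hj⟩
        refine ⟨𝔭, h1 (VNumber.mem_associatedPrimes_quotPow_iff.2 ?_), hj⟩
        exact VNumber.relAss_mono_right _ le_top (VNumber.mem_relAss_of_mem_annDegrees hp hj)
    have haff := (VNumber.EventuallyAffineMin.biUnion hfin fun 𝔭 hp =>
      (hlocal 𝔭 hp (hZ 𝔭) (hV 𝔭 hp)).2.2).congr hunion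
    obtain ⟨𝔭, hpA⟩ := hne
    have hnonempty : ∀ᶠ n in atTop,
        (VNumber.primeDegrees ℳ (I ^ n • N) (I ^ (n - 1) • N)).Nonempty := by
      filter_upwards [(hlocal 𝔭 hpA (hZ 𝔭) (hV 𝔭 hpA)).2.1] with n ⟨j, hj⟩
      exact ⟨j, 𝔭, hprime 𝔭 hpA, hj⟩
    obtain ⟨a, ha, b, hab⟩ := haff.resolve_of_nonempty hnonempty
    refine ⟨a, ha, b, ?_⟩
    have hZdeg : VNumber.primeDegrees ℳ ⊥ (VNumber.colonZero M I) = ∅ :=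
      Set.eq_empty_iff_forall_notMem.2 fun j ⟨𝔮, hq, hj⟩ =>
        hZ 𝔮 (VNumber.mem_relAss_of_mem_annDegrees hq hj)
    filter_upwards [hprimeSplit hV, hab] with n h1 h2
    rw [h1, hZdeg, Set.union_empty]
    refine ⟨rfl, ?_⟩
    rw [VNumber.infDeg_eq_of_isLeast h2]
    push_cast
    rfl
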